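/- Let $F$ be a field and let $A$ be a finite set of positive integers. A set composition of $A$ is a tuple $P=(P_1,\ldots,P_l)$, $l\ge 0$, of non-empty, mutually disjoint sets with union $A$; write $\ell(P)=l$ for its length, $\bigcup P=A$, and let $\Pi_A$ be the set of set compositions of $A$. Let $F\Pi_A$ be the $F$-algebra with basis $\Pi_A$ and product $$(P_1,\ldots,P_l)\wedge(Q_1,\ldots,Q_k)=(P_1\cap Q_1,\ldots,P_1\cap Q_k,\;\ldots\;,P_l\cap Q_1,\ldots,P_l\cap Q_k)^{\#},$$ where $\#$ means that empty sets are deleted. Let $\mathrm{rad}^{(0)}F\Pi_A=F\Pi_A$, and for $k\ge 0$ let $\mathrm{rad}^{(k+1)}F\Pi_A$ be the radical (the intersection of all maximal submodules) of the left $F\Pi_A$-module $\mathrm{rad}^{(k)}F\Pi_A$. Let $\Pi=\bigcup_B\Pi_B$ and $F\Pi=\bigoplus_B F\Pi_B$, over all finite sets $B$ of positive integers, and let $\vee$ be the bilinear product on $F\Pi$ such that, for $P,Q\in\Pi$, $P\vee Q$ is the concatenation of $P$ and $Q$ if $\bigcup P\cap\bigcup Q=\emptyset$, and $P\vee Q=0$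 otherwise; its identity is the empty tuple. Put $f\circ g=f\vee g-g\vee f$. For $(Q_1,\ldots,Q_k)\in\Pi$ with $k\ge1$ define the right-normed Lie monomial $$(Q_1,\ldots,Q_k)^\circ=Q_1\circ(Q_2\circ(\cdots\circ(Q_{k-1}\circ Q_k)\cdots)),$$ where the set $Q_i$ is identified with the set composition $(Q_i)$. For non-empty $B$ put $$e_B=\sum_{(P_1,\ldots,P_l)\in\Pi_B,\ \min B\in P_1}(-1)^{l-1}(P_1,\ldots,P_l),$$ put $e_Q=e_{Q_1}\vee\cdots\vee e_{Q_k}$ for $Q=(Q_1,\ldots,Q_k)\in\Pi$, and extend $Q\mapsto e_Q$ linearly to $F\Pi$. Let $\Pi^\dagger$ be the set of all $(Q_1,\ldots,Q_k)\in\Pi$ with $k\ge1$ and $\min(Q_1\cup\cdots\cup Q_k)\in Q_k$, and let $\Pi_A^<$ be the set of all $(Q_1,\ldots,Q_k)\in\Pi_A$ with $\min Q_1<\cdots<\min Q_k$. Then the elements $e_{Q(1)^\circ}\vee\cdots\vee e_{Q(m)^\circ}$, one for each tuple $(Q(1),\ldots,Q(m))$ such that (a) $m\ge 0$ is an integer;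 (b) $Q(i)\in\Pi^\dagger$ for all $i\in\{1,\ldots,m\}$; (c) $Q=Q(1)\vee\cdots\vee Q(m)\in\Pi_A$; (d) $\left(\bigcup Q(1),\ldots,\bigcup Q(m)\right)\in\Pi_A^<$; form a linear basis of $F\Pi_A$. For each integer $k\ge0$, those amongst these basis elements for which (e) $\ell(Q)=m+k$ span a linear complement of $\mathrm{rad}^{(k+1)}F\Pi_A$ in $\mathrm{rad}^{(k)}F\Pi_A$. -/

import Mathlib

namespace SolomonTits

noncomputable section

/-- A set composition: a finite sequence of non-empty, mutually disjoint finite sets of positive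
integers. The type of all of them is `Π = ⋃_A Π_A`; the empty sequence is the only set
composition of `∅`. -/
@[ext]
structure SetComp where
  parts : List (Finset ℕ+)
  nonempty : ∀ X ∈ parts, X.Nonempty
  disjoint : parts.Pairwise Disjoint

namespace SetComp

/-- The union `⋃ Q` of the components of `Q`. -/
def support (Q : SetComp) : Finset ℕ+ := Q.parts.foldr (· ∪ ·) ∅

/-- The length `ℓ(Q)`. -/
def length (Q : SetComp) : ℕ := Q.parts.length

theorem mem_foldr_union {l : List (Finset ℕ+)} {a : ℕ+} :
    a ∈ l.foldr (· ∪ ·) ∅ ↔ ∃ X ∈ l, a ∈ X := by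
  induction l with
  | nil => simp
  | cons Y l ih => simp [ih]

theorem mem_support {Q : SetComp} {a : ℕ+} : a ∈ Q.support ↔ ∃ X ∈ Q.parts, a ∈ X :=
  mem_foldr_union

/-- The empty tuple. -/
def empty : SetComp := ⟨[], by simp, by simp⟩

/-- The set composition `(X)` with a single component. -/
def single (X : Finset ℕ+) (h : X.Nonempty) : SetComp := ⟨[X], by simpa using h, by simp⟩

/-- The concatenation of two set compositions with disjoint supports. -/
def append (P Q : SetComp) (h : Disjoint P.support Q.support) : SetComp where
  parts := P.parts ++ Q.parts
  nonempty X hX := (List.mem_append.1 hX).elim (P.nonempty X) (Q.nonempty X)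
  disjoint := List.pairwise_append.2 ⟨P.disjoint, Q.disjoint, fun X hX Y hY =>
    Finset.disjoint_left.2 fun _ ha hb =>
      Finset.disjoint_left.1 h (mem_support.2 ⟨X, hX, ha⟩) (mem_support.2 ⟨Y, hY, hb⟩)⟩

/-- `Π_A`: the set compositions of `A`. -/
def On (A : Finset ℕ+) : Type := {Q : SetComp // Q.support = A}

/-- `Q ∈ Π_A^*` for `A = ⋃ Q`: the first component of `Q` contains `min A`. -/
def IsStar (Q : SetComp) : Prop :=
  ∃ X ∈ Q.parts.head?, ∃ a ∈ X, IsLeast (Q.support : Set ℕ+) a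

/-- `Q ∈ Π^†`: the last component of `Q` contains `min (⋃ Q)`. -/
def IsDagger (Q : SetComp) : Prop :=
  ∃ X ∈ Q.parts.getLast?, ∃ a ∈ X, IsLeast (Q.support : Set ℕ+) a

/-- `Q ∈ Π^<`: the minima of the components of `Q` are strictly increasing. -/
def IsIncreasing (Q : SetComp) : Prop :=
  Q.parts.Pairwise fun X Y => X.min < Y.min

/-! ### The intersection product on `Π_A` -/

/-- The list `(X₁ ∩ Y₁, …, X₁ ∩ Y_k, …, X_l ∩ Y₁, …, X_l ∩ Y_k)^#`, where `#` deletes the empty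
sets. -/
def wedgeList (P Q : List (Finset ℕ+)) : List (Finset ℕ+) :=
  P.flatMap fun X => (Q.map (X ∩ ·)).filter fun Z => decide (Z ≠ ∅)

theorem mem_wedgeList {P Q : List (Finset ℕ+)} {Z : Finset ℕ+} :
    Z ∈ wedgeList P Q ↔ ∃ X ∈ P, ∃ Y ∈ Q, X ∩ Y = Z ∧ Z ≠ ∅ := by
  simp only [wedgeList, List.mem_flatMap, List.mem_filter, List.mem_map, decide_eq_true_eq]
  grind

theorem wedgeList_assoc (P Q R : List (Finset ℕ+)) :
    wedgeList (wedgeList P Q) R = wedgeList P (wedgeList Q R) := by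
  have key : ∀ (X : Finset ℕ+) (Q : List (Finset ℕ+)),
      wedgeList ((Q.map (X ∩ ·)).filter fun Z => decide (Z ≠ ∅)) R
        = ((wedgeList Q R).map (X ∩ ·)).filter fun Z => decide (Z ≠ ∅) := by
    intro X Q
    have inner : ∀ (Y : Finset ℕ+) (R : List (Finset ℕ+)),
        (((R.map (Y ∩ ·)).filter fun Z => decide (Z ≠ ∅)).map (X ∩ ·)).filter
            (fun Z => decide (Z ≠ ∅))
          = (R.map ((X ∩ Y) ∩ ·)).filter fun Z => decide (Z ≠ ∅) := by
      intro Y R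
      induction R with
      | nil => rfl
      | cons W R ih =>
        by_cases h1 : Y ∩ W = ∅
        · have h2 : X ∩ Y ∩ W = ∅ := by rw [Finset.inter_assoc, h1, Finset.inter_empty]
          simpa [h1, h2] using ih
        · by_cases h2 : X ∩ Y ∩ W = ∅
          · have h3 : X ∩ (Y ∩ W) = ∅ := by rw [← Finset.inter_assoc, h2]
            simpa [h1, h2, h3] using ih
          · have h3 : X ∩ (Y ∩ W) ≠ ∅ := by rwa [← Finset.inter_assoc]
            simpa [h1, h2, h3, Finset.inter_assoc] using ih
    induction Q with
    | nil => rfl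
    | cons Y Q ih =>
      have hr : wedgeList (Y :: Q) R
          = ((R.map (Y ∩ ·)).filter fun Z => decide (Z ≠ ∅)) ++ wedgeList Q R := by
        simp [wedgeList]
      rw [hr, List.map_append, List.filter_append, inner, ← ih]
      by_cases h : X ∩ Y = ∅
      · simp [h]
      · simp [h, wedgeList]
  induction P with
  | nil => rfl
  | cons X P ih =>
    have h1 : wedgeList (X :: P) Q
        = ((Q.map (X ∩ ·)).filter fun Z => decide (Z ≠ ∅)) ++ wedgeList P Q := by
      simp [wedgeList]
    have h2 : wedgeList (X :: P) (wedgeList Q R)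
        = (((wedgeList Q R).map (X ∩ ·)).filter fun Z => decide (Z ≠ ∅))
          ++ wedgeList P (wedgeList Q R) := by
      simp [wedgeList]
    have h3 : ∀ L M : List (Finset ℕ+),
        wedgeList (L ++ M) R = wedgeList L R ++ wedgeList M R := by
      intro L M
      simp [wedgeList]
    rw [h1, h2, h3, key, ih]

/-- The set composition with components `wedgeList P.parts Q.parts`. -/
def wedge (P Q : SetComp) : SetComp where
  parts := wedgeList P.parts Q.parts
  nonempty Z hZ := by
    obtain ⟨X, -, Y, -, -, h⟩ := mem_wedgeList.1 hZ
    exact Finset.nonempty_iff_ne_empty.2 h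
  disjoint := by
    refine List.pairwise_flatMap.2 ⟨fun X _ => ?_, ?_⟩
    · refine List.Pairwise.filter _ (List.pairwise_map.2 (Q.disjoint.imp ?_))
      exact fun h => h.mono Finset.inter_subset_right Finset.inter_subset_right
    · refine P.disjoint.imp fun {X X'} h Z hZ Z' hZ' => ?_
      simp only [List.mem_filter, List.mem_map] at hZ hZ'
      obtain ⟨⟨Y, -, rfl⟩, -⟩ := hZ
      obtain ⟨⟨Y', -, rfl⟩, -⟩ := hZ'
      exact h.mono Finset.inter_subset_left Finset.inter_subset_left

theorem support_wedge (P Q : SetComp) : (wedge P Q).support = P.support ∩ Q.support := by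
  ext a
  simp only [mem_support, Finset.mem_inter, wedge, mem_wedgeList]
  constructor
  · rintro ⟨Z, ⟨X, hX, Y, hY, rfl, -⟩, ha⟩
    rw [Finset.mem_inter] at ha
    exact ⟨⟨X, hX, ha.1⟩, ⟨Y, hY, ha.2⟩⟩
  · rintro ⟨⟨X, hX, ha⟩, ⟨Y, hY, hb⟩⟩
    have hab : a ∈ X ∩ Y := Finset.mem_inter.2 ⟨ha, hb⟩
    exact ⟨X ∩ Y, ⟨X, hX, Y, hY, rfl, Finset.ne_empty_of_mem hab⟩, hab⟩

/-- The semigroup with identity `(Π_A, ∧_A)`. The identity is `(A)`, or the empty tuple if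
`A = ∅`. -/
instance (A : Finset ℕ+) : Monoid (On A) where
  mul P Q := ⟨wedge P.1 Q.1, by rw [support_wedge, P.2, Q.2, Finset.inter_self]⟩
  one := if h : A.Nonempty then ⟨single A h, by simp [support, single]⟩
    else ⟨empty, by simp [support, empty, Finset.not_nonempty_iff_eq_empty.1 h]⟩
  mul_assoc P Q R := Subtype.ext (SetComp.ext (wedgeList_assoc _ _ _))
  one_mul P := by
    refine Subtype.ext (SetComp.ext ?_)
    change wedgeList (SetComp.parts (Subtype.val (dite _ _ _))) P.1.parts = P.1.parts
    by_cases h : A.Nonempty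
    · have hmap : P.1.parts.map (A ∩ ·) = P.1.parts := by
        conv_rhs => rw [← List.map_id P.1.parts]
        refine List.map_congr_left fun X hX => ?_
        refine Finset.inter_eq_right.2 fun a ha => ?_
        rw [← P.2]
        exact mem_support.2 ⟨X, hX, ha⟩
      rw [dif_pos h]
      simp only [single, wedgeList, List.flatMap_cons, List.flatMap_nil, List.append_nil, hmap]
      refine List.filter_eq_self.2 fun X hX => ?_
      simpa using (P.1.nonempty X hX).ne_empty
    · rw [dif_neg h]
      cases hP : P.1.parts with
      | nil => rfl
      | cons X l =>
        have hX : X ∈ P.1.parts := by simp [hP]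
        obtain ⟨a, ha⟩ := P.1.nonempty X hX
        exact absurd ⟨a, P.2 ▸ mem_support.2 ⟨X, hX, ha⟩⟩ h
  mul_one P := by
    refine Subtype.ext (SetComp.ext ?_)
    change wedgeList P.1.parts (SetComp.parts (Subtype.val (dite _ _ _))) = P.1.parts
    by_cases h : A.Nonempty
    · rw [dif_pos h]
      have key : ∀ l : List (Finset ℕ+), (∀ X ∈ l, X.Nonempty) → (∀ X ∈ l, X ⊆ A) →
          wedgeList l [A] = l := by
        intro l
        induction l with
        | nil => intros; rfl
        | cons X l ih =>
          intro hn hs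
          have h1 : X ∩ A = X := Finset.inter_eq_left.2 (hs X (by simp))
          have h2 : X ≠ ∅ := (hn X (by simp)).ne_empty
          have h3 := ih (fun Y hY => hn Y (by simp [hY])) (fun Y hY => hs Y (by simp [hY]))
          simp only [wedgeList] at h3
          simp only [wedgeList, List.flatMap_cons, h3]
          simp [h1, h2]
      refine key _ P.1.nonempty fun X hX a ha => ?_
      rw [← P.2]
      exact mem_support.2 ⟨X, hX, ha⟩
    · rw [dif_neg h]
      cases hP : P.1.parts with
      | nil => rfl
      | cons X l =>
        have hX : X ∈ P.1.parts := by simp [hP]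
        obtain ⟨a, ha⟩ := P.1.nonempty X hX
        exact absurd ⟨a, P.2 ▸ mem_support.2 ⟨X, hX, ha⟩⟩ h

theorem nodup_parts (Q : SetComp) : Q.parts.Nodup := by
  refine List.Pairwise.imp_of_mem (fun {X Y} hX _ hd he => ?_) Q.disjoint
  subst he
  exact (Q.nonempty X hX).ne_empty (disjoint_self.1 hd)

instance (A : Finset ℕ+) : Finite (On A) := by
  have hmem : ∀ Q : On A, ∀ X ∈ Q.1.parts, X ∈ A.powerset := fun Q X hX =>
    Finset.mem_powerset.2 fun a ha => Q.2 ▸ mem_support.2 ⟨X, hX, ha⟩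
  have hval : ∀ Q : On A,
      (Q.1.parts.attachWith (· ∈ A.powerset) (hmem Q)).map Subtype.val = Q.1.parts := by
    intro Q
    simp
  refine Finite.of_injective (β := {l : List {X // X ∈ A.powerset} // l.Nodup})
    (fun Q => ⟨Q.1.parts.attachWith (· ∈ A.powerset) (hmem Q), ?_⟩) ?_
  · refine List.Nodup.of_map Subtype.val ?_
    rw [hval]
    exact nodup_parts _
  · intro P Q h
    have h' := congrArg (List.map Subtype.val) (Subtype.ext_iff.1 h)
    simp only [hval] at h'
    exact Subtype.ext (SetComp.ext h')

instance (A : Finset ℕ+) : Fintype (On A) := Fintype.ofFinite _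

end SetComp

open SetComp

/-- The Solomon-Tits algebra `(FΠ_A, ∧)`: the semigroup algebra of `(Π_A, ∧_A)`. -/
abbrev FPiOn (F : Type*) [Field F] (A : Finset ℕ+) := MonoidAlgebra F (On A)

/-- `FΠ = ⨁_A FΠ_A`, the vector space with basis `Π`. -/
abbrev FPi (F : Type*) [Field F] := SetComp →₀ F

variable (F : Type*) [Field F]

/-- The embedding of `FΠ_A` in `FΠ` as a direct summand. -/
def incl (A : Finset ℕ+) : FPiOn F A →ₗ[F] FPi F :=
  Finsupp.lmapDomain F F Subtype.val ∘ₗ (MonoidAlgebra.coeffLinearEquiv F).toLinearMap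

/-- The concatenation product `∨` on `FΠ`, a bilinear map. -/
def vee : FPi F →ₗ[F] FPi F →ₗ[F] FPi F :=
  Finsupp.lift _ F SetComp fun P => Finsupp.lift _ F SetComp fun Q =>
    if h : Disjoint P.support Q.support then Finsupp.single (append P Q h) 1 else 0

/-- The product `f₁ ∨ ⋯ ∨ f_m`; the product of no factors is the identity `∅` of `(FΠ, ∨)`. -/
def veeProd (l : List (FPi F)) : FPi F :=
  l.foldr (fun f g => vee F f g) (Finsupp.single SetComp.empty 1)

/-- The Lie product `f ∘ g = f ∨ g - g ∨ f`. -/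
def lie (f g : FPi F) : FPi F := vee F f g - vee F g f

/-- The idempotent `e_A = ∑_{P ∈ Π_A^*} (-1)^{ℓ(P) - 1} P` (used for non-empty `A` only). -/
def eSet (A : Finset ℕ+) : FPi F := by
  classical
  exact ∑ P : On A with P.1.IsStar, Finsupp.single P.1 ((-1) ^ (P.1.length - 1))

/-- `e_Q = e_{Q₁} ∨ ⋯ ∨ e_{Q_k}`. -/
def eComp (Q : SetComp) : FPi F := veeProd F (Q.parts.map (eSet F))

/-- The linear extension `e_f = ∑ f_R e_R` of `R ↦ e_R` to all `f = ∑ f_R R` in `FΠ`. -/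
def eLin : FPi F →ₗ[F] FPi F := Finsupp.linearCombination F (eComp F)

/-- The right-normed Lie monomial `Q₁ ∘ (Q₂ ∘ (⋯ ∘ Q_k))`; the value at the empty tuple is
irrelevant and set to `0`. -/
def dynkin : (l : List (Finset ℕ+)) → (∀ X ∈ l, X.Nonempty) → FPi F
  | [], _ => 0
  | [X], h => Finsupp.single (SetComp.single X (h X (by simp))) 1
  | X :: Y :: l, h =>
    lie F (Finsupp.single (SetComp.single X (h X (by simp))) 1)
      (dynkin (Y :: l) fun Z hZ => h Z (List.mem_cons_of_mem _ hZ))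

/-- `Q°`, the image of `Q ∈ Π` under the Dynkin mapping. -/
def circ (Q : SetComp) : FPi F := dynkin F Q.parts Q.nonempty

/-- A sequence `(Q(1), …, Q(m))` of elements of `Π^†` such that `Q = Q(1) ∨ ⋯ ∨ Q(m)` is a set
composition of `A` and `(⋃ Q(1), …, ⋃ Q(m)) ∈ Π_A^<`. The field `total` is `Q`; it is determined
by `factors`. -/
@[ext]
structure PBWIndex (A : Finset ℕ+) where
  factors : List SetComp
  total : SetComp
  dagger : ∀ R ∈ factors, R.IsDagger
  total_parts : total.parts = (factors.map SetComp.parts).flatten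
  total_support : total.support = A
  increasing : ∃ P : SetComp, P.parts = factors.map SetComp.support ∧ P.support = A ∧
    P.IsIncreasing

/-- The element `e_{Q(1)°} ∨ ⋯ ∨ e_{Q(m)°}` of `FΠ`. -/
def pbwElement {A : Finset ℕ+} (i : PBWIndex A) : FPi F :=
  veeProd F (i.factors.map fun R => eLin F (circ F R))

/-- The descending Loewy series of a left module: `rad^{(0)} M = M`, and `rad^{(k+1)} M` is the
radical (the intersection of all maximal submodules) of `rad^{(k)} M`. -/
def loewy (R M : Type*) [Ring R] [AddCommGroup M] [Module R M] : ℕ → Submodule R M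
  | 0 => ⊤
  | k + 1 => (Module.jacobson R (loewy R M k)).map (loewy R M k).subtype

/-- `rad^{(k)} FΠ_A`, the `k`th term of the descending Loewy series of the left regular module of
`(FΠ_A, ∧)`, as a subspace. -/
def radPow (A : Finset ℕ+) (k : ℕ) : Submodule F (FPiOn F A) :=
  (loewy (FPiOn F A) (FPiOn F A) k).restrictScalars F

/-- `S` is a linear complement of the subspace `U` in the subspace `W`: `W = U ⊕ S`. -/
def IsComplementIn {F V : Type*} [Field F] [AddCommGroup V] [Module F V]
    (S U W : Submodule F V) : Prop :=
  Disjoint U S ∧ U ⊔ S = W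

end

end SolomonTits

open SolomonTits SolomonTits.SetComp TensorProduct

namespace SolomonTits

variable {F : Type*} [Field F]

namespace SetComp

/-! For a set S, the map R ↦ R|_S ⊗ R|_{Sᶜ} (`cop`) is multiplicative for concatenation (`cop_vee`).
Each e_B is primitive: every S that cuts B properly kills it, by a sign-reversing involution
(`cop_eSet_eq_zero`). Hence Lie monomials in the e_X are primitive too. Intersecting with a first
component X is restriction to X, so left multiplication by P is an iterated coproduct followed by
concatenation (`wedgeLeft_cons`). On a product of Lie monomials, P therefore acts combinatorially:
if every factor is supported in a component of P, the factors are stably sorted by component;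
otherwise the result is 0 (`wedgeLeft_factProd_aux`).

Let the degree of a product be the sum of ℓ - 1 over its factors. By the Jacobi identity, the
bracket of two factors is a combination of single Lie monomials of degree one higher, again with the
minimum in the last place (`lie_brk_brk_mem_lieSpan`). Factors thus commute modulo higher degree,
and sorted products span (`filt_le_sortedFilt`, `graded_le_filt`). A sorted product can be recovered
from its concatenation, so there are at most |Π_A| of them and they form a basis
(`exists_basis_pbwElement`).

The spans of the products of degree at least k are left ideals, and they are the Loewy series. On
the quotient of the kth by the next, every P acts diagonally in the basis with entries 0 and 1. The
kernels of the degree-k coordinates are then maximal submodules, and their intersection is the next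
ideal; this bounds the radical from above (`radSub_le_idealFilt_succ`). Conversely, a product of
degree at least k+1 has a factor e_X ∘ g. It equals (P - P') ∧ w, where w keeps e_X and g as
separate factors and P, P' arrange these in the two orders. The element P - P' raises the
filtration, hence lies in the Jacobson radical (`exists_jacobson_mul_eq`). -/

@[simp] theorem support_empty : SetComp.empty.support = ∅ := rfl

@[simp] theorem support_single (X : Finset ℕ+) (h : X.Nonempty) : (single X h).support = X := by
  simp [support, single]

@[simp] theorem support_append (P Q : SetComp) (h : Disjoint P.support Q.support) :
    (append P Q h).support = P.support ∪ Q.support := by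
  ext a
  simp only [mem_support, Finset.mem_union, append, List.mem_append, or_and_right, exists_or]

end SetComp

/-! ### The concatenation algebra and its Lie bracket -/

/-- The unit of the concatenation product. -/
noncomputable def veeOne (F : Type*) [Field F] : FPi F := Finsupp.single SetComp.empty 1

theorem vee_single (P Q : SetComp) (a b : F) :
    vee F (Finsupp.single P a) (Finsupp.single Q b) =
      if h : Disjoint P.support Q.support then Finsupp.single (append P Q h) (a * b) else 0 := by
  simp only [vee, Finsupp.lift_apply, zero_smul, Finsupp.sum_single_index, LinearMap.smul_apply]
  split_ifs <;> simp

@[simp] theorem veeOne_vee (f : FPi F) : vee F (veeOne F) f = f := by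
  induction f using Finsupp.induction_linear with
  | zero => simp
  | add f g hf hg => rw [map_add, hf, hg]
  | single Q a =>
    rw [veeOne, vee_single, dif_pos (by simp), one_mul]
    congr 1

@[simp] theorem vee_veeOne (f : FPi F) : vee F f (veeOne F) = f := by
  induction f using Finsupp.induction_linear with
  | zero => simp
  | add f g hf hg => rw [map_add, LinearMap.add_apply, hf, hg]
  | single Q a =>
    rw [veeOne, vee_single, dif_pos (by simp), mul_one]
    congr 1
    ext1
    simp [append, SetComp.empty]

theorem vee_assoc (f g h : FPi F) : vee F (vee F f g) h = vee F f (vee F g h) := by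
  induction f using Finsupp.induction_linear with
  | zero => simp
  | add f f' hf hf' => simp only [map_add, LinearMap.add_apply, hf, hf']
  | single P a =>
  induction g using Finsupp.induction_linear with
  | zero => simp
  | add f f' hf hf' => simp only [map_add, LinearMap.add_apply, hf, hf']
  | single Q b =>
  induction h using Finsupp.induction_linear with
  | zero => simp
  | add f f' hf hf' => simp only [map_add, hf, hf']
  | single R c =>
    rw [vee_single, vee_single]
    by_cases h1 : Disjoint P.support Q.support <;> by_cases h2 : Disjoint Q.support R.support
    · rw [dif_pos h1, dif_pos h2, vee_single, vee_single]
      by_cases h3 : Disjoint P.support R.support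
      · rw [dif_pos (by simp [h2, h3]), dif_pos (by simp [h1, h3])]
        simp [append, mul_assoc]
      · rw [dif_neg (by simp [h3]), dif_neg (by simp [h3])]
    · rw [dif_pos h1, dif_neg h2, vee_single, dif_neg (by simp [h2])]
      simp
    · rw [dif_neg h1, dif_pos h2, vee_single, dif_neg (by simp [h1])]
      simp
    · rw [dif_neg h1, dif_neg h2]
      simp

theorem veeProd_nil : veeProd F [] = veeOne F := rfl

theorem veeProd_cons (f : FPi F) (l : List (FPi F)) :
    veeProd F (f :: l) = vee F f (veeProd F l) := rfl

theorem veeProd_append (l l' : List (FPi F)) :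
    veeProd F (l ++ l') = vee F (veeProd F l) (veeProd F l') := by
  induction l with
  | nil => rw [List.nil_append, veeProd_nil, veeOne_vee]
  | cons f l ih => rw [List.cons_append, veeProd_cons, veeProd_cons, ih, vee_assoc]

theorem lie_antisymm (f g : FPi F) : lie F f g = -lie F g f := by
  simp [lie]

theorem lie_lie (f g h : FPi F) :
    lie F (lie F f g) h = lie F f (lie F g h) - lie F g (lie F f h) := by
  simp only [lie, map_sub, LinearMap.sub_apply, vee_assoc]
  abel

/-! ### Grading by support -/

/-- The subspace of `FΠ` spanned by the set compositions of `B`. -/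
def graded (F : Type*) [Field F] (B : Finset ℕ+) : Submodule F (FPi F) :=
  Finsupp.supported F F {R : SetComp | R.support = B}

theorem graded_eq_span (B : Finset ℕ+) :
    graded F B = Submodule.span F ((fun R => Finsupp.single R 1) '' {R : SetComp | R.support = B}) :=
  Finsupp.supported_eq_span_single F _

theorem single_mem_graded {B : Finset ℕ+} {R : SetComp} (h : R.support = B) (a : F) :
    Finsupp.single R a ∈ graded F B :=
  Finsupp.single_mem_supported F a h

theorem veeOne_mem_graded : veeOne F ∈ graded F ∅ := single_mem_graded rfl 1

/-- To prove an `F`-linear statement about an element of `graded F B`, it suffices to check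
the basis elements. -/
theorem graded_induction {B : Finset ℕ+} {p : FPi F → Prop}
    (single : ∀ R : SetComp, R.support = B → p (Finsupp.single R 1)) (zero : p 0)
    (add : ∀ f g, p f → p g → p (f + g)) (smul : ∀ (a : F) f, p f → p (a • f))
    {f : FPi F} (hf : f ∈ graded F B) : p f := by
  rw [graded_eq_span] at hf
  induction hf using Submodule.span_induction with
  | mem x h =>
    obtain ⟨R, hR, rfl⟩ := h
    exact single R hR
  | zero => exact zero
  | add x y _ _ hx hy => exact add _ _ hx hy
  | smul a x _ hx => exact smul _ _ hx

theorem vee_mem_graded {B C : Finset ℕ+} {f g : FPi F} (hf : f ∈ graded F B)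
    (hg : g ∈ graded F C) : vee F f g ∈ graded F (B ∪ C) := by
  refine graded_induction (p := fun f => vee F f g ∈ graded F (B ∪ C)) (fun P hP => ?_) (by simp)
    (fun f g hf hg => by simpa using add_mem hf hg)
    (fun a f hf => by simpa using Submodule.smul_mem _ a hf) hf
  refine graded_induction (p := fun g => vee F _ g ∈ graded F (B ∪ C)) (fun Q hQ => ?_) (by simp)
    (fun f g hf hg => by simpa using add_mem hf hg)
    (fun a f hf => by simpa using Submodule.smul_mem _ a hf) hg
  rw [vee_single]
  split_ifs with h
  · exact single_mem_graded (by simp [hP, hQ]) _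
  · exact zero_mem _

theorem vee_eq_zero {B C : Finset ℕ+} {f g : FPi F} (hf : f ∈ graded F B)
    (hg : g ∈ graded F C) (h : ¬ Disjoint B C) : vee F f g = 0 := by
  refine graded_induction (p := fun f => vee F f g = 0) (fun P hP => ?_) (by simp)
    (fun f g hf hg => by simp [hf, hg]) (fun a f hf => by simp [hf]) hf
  refine graded_induction (p := fun g => vee F _ g = 0) (fun Q hQ => ?_) (by simp)
    (fun f g hf hg => by simp [hf, hg]) (fun a f hf => by simp [hf]) hg
  rw [vee_single, dif_neg (by rwa [hP, hQ])]

theorem lie_mem_graded {B C : Finset ℕ+} {f g : FPi F} (hf : f ∈ graded F B)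
    (hg : g ∈ graded F C) : lie F f g ∈ graded F (B ∪ C) :=
  sub_mem (vee_mem_graded hf hg) (Finset.union_comm C B ▸ vee_mem_graded hg hf)

theorem eSet_mem_graded (B : Finset ℕ+) : eSet F B ∈ graded F B :=
  Submodule.sum_mem _ fun P _ => single_mem_graded P.2 _

theorem veeProd_eSet_mem_graded (l : List (Finset ℕ+)) :
    veeProd F (l.map (eSet F)) ∈ graded F (l.foldr (· ∪ ·) ∅) := by
  induction l with
  | nil => exact veeOne_mem_graded
  | cons X l ih => exact vee_mem_graded (eSet_mem_graded X) ih

theorem eComp_mem_graded (Q : SetComp) : eComp F Q ∈ graded F Q.support :=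
  veeProd_eSet_mem_graded _

@[simp] theorem eLin_single (Q : SetComp) (a : F) :
    eLin F (Finsupp.single Q a) = a • eComp F Q := by
  simp [eLin]

theorem eLin_vee (f g : FPi F) : eLin F (vee F f g) = vee F (eLin F f) (eLin F g) := by
  induction f using Finsupp.induction_linear with
  | zero => simp
  | add f f' hf hf' => simp only [map_add, LinearMap.add_apply, hf, hf']
  | single P a =>
  induction g using Finsupp.induction_linear with
  | zero => simp
  | add f f' hf hf' => simp only [map_add, hf, hf']
  | single Q b =>
    rw [vee_single]
    simp only [eLin_single, map_smul, LinearMap.smul_apply]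
    split_ifs with h
    · rw [eLin_single, eComp, append, List.map_append, veeProd_append, mul_comm, mul_smul,
        smul_comm, smul_comm b]
      rfl
    · rw [vee_eq_zero (eComp_mem_graded P) (eComp_mem_graded Q) h]
      simp

/-! ### Restriction and the coproduct -/

open Classical in
/-- The intersections of the sets in `l` with `S`, without the empty ones. -/
noncomputable def resList (S : Set ℕ+) (l : List (Finset ℕ+)) : List (Finset ℕ+) :=
  (l.map fun X => X.filter (· ∈ S)).filter fun Z => decide (Z ≠ ∅)

@[simp] theorem resList_nil (S : Set ℕ+) : resList S [] = [] := rfl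

open Classical in
theorem resList_cons (S : Set ℕ+) (X : Finset ℕ+) (l : List (Finset ℕ+)) :
    resList S (X :: l) =
      if X.filter (· ∈ S) = ∅ then resList S l else X.filter (· ∈ S) :: resList S l := by
  by_cases h : X.filter (· ∈ S) = ∅
  · rw [if_pos h, resList, List.map_cons, List.filter_cons_of_neg (by simpa using h)]
    rfl
  · rw [if_neg h, resList, List.map_cons, List.filter_cons_of_pos (by simpa using h)]
    rfl

theorem resList_append (S : Set ℕ+) (l l' : List (Finset ℕ+)) :
    resList S (l ++ l') = resList S l ++ resList S l' := by
  simp [resList]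

open Classical in
theorem mem_resList {S : Set ℕ+} {l : List (Finset ℕ+)} {Z : Finset ℕ+} :
    Z ∈ resList S l ↔ (∃ X ∈ l, X.filter (· ∈ S) = Z) ∧ Z ≠ ∅ := by
  simp [resList]

theorem resList_eq_self {S : Set ℕ+} {l : List (Finset ℕ+)} (hl : ∀ X ∈ l, X.Nonempty)
    (h : ∀ X ∈ l, ∀ a ∈ X, a ∈ S) : resList S l = l := by
  classical
  induction l with
  | nil => rfl
  | cons X l ih =>
    have hX : X.filter (· ∈ S) = X := Finset.filter_true_of_mem (h X (by simp))
    rw [resList_cons, hX, if_neg (hl X (by simp)).ne_empty,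
      ih (fun Y hY => hl Y (by simp [hY])) (fun Y hY => h Y (by simp [hY]))]

theorem resList_eq_nil {S : Set ℕ+} {l : List (Finset ℕ+)}
    (h : ∀ X ∈ l, ∀ a ∈ X, a ∉ S) : resList S l = [] := by
  classical
  rw [List.eq_nil_iff_forall_not_mem]
  rintro Z hZ
  obtain ⟨⟨X, hX, rfl⟩, h2⟩ := mem_resList.1 hZ
  exact h2 (Finset.filter_false_of_mem (h X hX))

/-- The restriction of a set composition to the elements of `S`. -/
noncomputable def res (S : Set ℕ+) (R : SetComp) : SetComp where
  parts := resList S R.parts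
  nonempty Z hZ := by
    classical
    exact Finset.nonempty_iff_ne_empty.2 (mem_resList.1 hZ).2
  disjoint := by
    classical
    refine List.Pairwise.filter _ (List.pairwise_map.2 (R.disjoint.imp fun h => ?_))
    exact h.mono (Finset.filter_subset _ _) (Finset.filter_subset _ _)

theorem mem_support_res {S : Set ℕ+} {R : SetComp} {a : ℕ+} :
    a ∈ (res S R).support ↔ a ∈ R.support ∧ a ∈ S := by
  classical
  simp only [mem_support, res, mem_resList]
  constructor
  · rintro ⟨_, ⟨⟨X, hX, rfl⟩, -⟩, h⟩
    rw [Finset.mem_filter] at h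
    exact ⟨⟨X, hX, h.1⟩, h.2⟩
  · rintro ⟨⟨X, hX, h⟩, hS⟩
    have := Finset.mem_filter.2 ⟨h, hS⟩
    exact ⟨_, ⟨⟨X, hX, rfl⟩, Finset.ne_empty_of_mem this⟩, this⟩

theorem res_append (S : Set ℕ+) (P Q : SetComp) (h : Disjoint P.support Q.support)
    (h' : Disjoint (res S P).support (res S Q).support) :
    res S (append P Q h) = append (res S P) (res S Q) h' :=
  SetComp.ext (resList_append _ _ _)

theorem res_eq_self {S : Set ℕ+} {R : SetComp} (h : ∀ a ∈ R.support, a ∈ S) : res S R = R :=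
  SetComp.ext (resList_eq_self R.nonempty fun X hX a ha => h a (mem_support.2 ⟨X, hX, ha⟩))

theorem res_eq_empty {S : Set ℕ+} {R : SetComp} (h : ∀ a ∈ R.support, a ∉ S) :
    res S R = SetComp.empty :=
  SetComp.ext (resList_eq_nil fun X hX a ha => h a (mem_support.2 ⟨X, hX, ha⟩))

/-- The component `R ↦ R|_S ⊗ R|_{Sᶜ}` of the coproduct of `FΠ`. -/
noncomputable def cop (F : Type*) [Field F] (S : Set ℕ+) : FPi F →ₗ[F] FPi F ⊗[F] FPi F :=
  Finsupp.linearCombination F fun R =>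
    Finsupp.single (res S R) 1 ⊗ₜ Finsupp.single (res Sᶜ R) 1

@[simp] theorem cop_single (S : Set ℕ+) (R : SetComp) (a : F) :
    cop F S (Finsupp.single R a) =
      a • (Finsupp.single (res S R) 1 ⊗ₜ Finsupp.single (res Sᶜ R) 1) := by
  simp [cop]

/-- Restriction respects concatenation. If the supports share a point x, then x survives in the
restrictions to S or in those to Sᶜ, so one tensor factor on the right vanishes as well. -/
theorem cop_vee (S : Set ℕ+) (f g : FPi F) :
    cop F S (vee F f g) = TensorProduct.map₂ (vee F) (vee F) (cop F S f) (cop F S g) := by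
  induction f using Finsupp.induction_linear with
  | zero => simp
  | add f f' hf hf' => simp only [map_add, LinearMap.add_apply, hf, hf']
  | single P a =>
  induction g using Finsupp.induction_linear with
  | zero => simp
  | add f f' hf hf' => simp only [map_add, hf, hf']
  | single Q b =>
    rw [vee_single]
    simp only [cop_single, map_smul, LinearMap.smul_apply, TensorProduct.map₂_apply_tmul,
      TensorProduct.map_tmul, vee_single]
    by_cases h : Disjoint P.support Q.support
    · have h' : ∀ T : Set ℕ+, Disjoint (res T P).support (res T Q).support := fun T =>
        Finset.disjoint_left.2 fun x hx hy => Finset.disjoint_left.1 h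
          (mem_support_res.1 hx).1 (mem_support_res.1 hy).1
      rw [dif_pos h, dif_pos (h' S), dif_pos (h' Sᶜ), cop_single,
        res_append S P Q h (h' S), res_append Sᶜ P Q h (h' Sᶜ)]
      simp [mul_smul, smul_comm a b]
    · obtain ⟨x, hx, hy⟩ := Finset.not_disjoint_iff.1 h
      have h' : ∀ T : Set ℕ+, x ∈ T → ¬ Disjoint (res T P).support (res T Q).support :=
        fun T hT => Finset.not_disjoint_iff.2
          ⟨x, mem_support_res.2 ⟨hx, hT⟩, mem_support_res.2 ⟨hy, hT⟩⟩
      rw [dif_neg h]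
      by_cases hS : x ∈ S
      · simp [dif_neg (h' S hS)]
      · simp [dif_neg (h' Sᶜ hS)]

theorem cop_eq_tmul_one {S : Set ℕ+} {B : Finset ℕ+} {f : FPi F} (hf : f ∈ graded F B)
    (h : ∀ a ∈ B, a ∈ S) : cop F S f = f ⊗ₜ veeOne F := by
  refine graded_induction (p := fun f => cop F S f = f ⊗ₜ veeOne F) (fun R hR => ?_)
    (by simp) (fun f g hf hg => by simp [hf, hg, TensorProduct.add_tmul])
    (fun a f hf => by rw [map_smul, hf, TensorProduct.smul_tmul']) hf
  rw [cop_single, one_smul, res_eq_self (by rwa [hR]), res_eq_empty (by rw [hR]; simpa using h)]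
  rfl

theorem cop_eq_one_tmul {S : Set ℕ+} {B : Finset ℕ+} {f : FPi F} (hf : f ∈ graded F B)
    (h : ∀ a ∈ B, a ∉ S) : cop F S f = veeOne F ⊗ₜ f := by
  refine graded_induction (p := fun f => cop F S f = veeOne F ⊗ₜ f) (fun R hR => ?_)
    (by simp) (fun f g hf hg => by simp [hf, hg, TensorProduct.tmul_add])
    (fun a f hf => by rw [map_smul, hf, TensorProduct.tmul_smul]) hf
  rw [cop_single, one_smul, res_eq_empty (by rwa [hR]), res_eq_self (by rw [hR]; simpa using h)]
  rfl

/-- The homogeneous elements of degree `B` that are primitive with respect to the coproduct. -/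
def IsPrim (B : Finset ℕ+) (f : FPi F) : Prop :=
  f ∈ graded F B ∧ ∀ S : Set ℕ+, (∃ a ∈ B, a ∈ S) → (∃ a ∈ B, a ∉ S) → cop F S f = 0

/-- If S cuts B or C properly, one coproduct is already 0. Otherwise S separates B from C, and both
orders of multiplication give the same pure tensor, which cancels in the bracket. -/
theorem IsPrim.lie {B C : Finset ℕ+} {f g : FPi F} (hf : IsPrim B f) (hg : IsPrim C g) :
    IsPrim (B ∪ C) (lie F f g) := by
  refine ⟨lie_mem_graded hf.1 hg.1, fun S hS hS' => ?_⟩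
  rw [SolomonTits.lie, map_sub, cop_vee, cop_vee]
  by_cases h1 : ∃ a ∈ B, a ∈ S
  · by_cases h2 : ∃ a ∈ B, a ∉ S
    · simp [hf.2 S h1 h2]
    · by_cases h3 : ∃ a ∈ C, a ∈ S
      · by_cases h4 : ∃ a ∈ C, a ∉ S
        · simp [hg.2 S h3 h4]
        · grind
      · push Not at h2 h3
        simp [cop_eq_tmul_one hf.1 h2, cop_eq_one_tmul hg.1 h3, TensorProduct.map₂_apply_tmul]
  · by_cases h3 : ∃ a ∈ C, a ∈ S
    · by_cases h4 : ∃ a ∈ C, a ∉ S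
      · simp [hg.2 S h3 h4]
      · push Not at h1 h4
        simp [cop_eq_tmul_one hg.1 h4, cop_eq_one_tmul hf.1 h1, TensorProduct.map₂_apply_tmul]
    · grind

/-! ### A sign-reversing involution and the primitivity of e_B -/

open Classical in
/-- Merge the first set of a list that is disjoint from `S` with its predecessor, or split the
first set that is neither contained in nor disjoint from `S`, whichever comes first. -/
noncomputable def toggle (S : Set ℕ+) : List (Finset ℕ+) → List (Finset ℕ+)
  | [] => []
  | [X] => if ∀ a ∈ X, a ∈ S then [X] else [X.filter (· ∈ S), X.filter (· ∉ S)]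
  | X :: Y :: l =>
    if ∀ a ∈ X, a ∈ S then
      if ∀ a ∈ Y, a ∉ S then (X ∪ Y) :: l else X :: toggle S (Y :: l)
    else X.filter (· ∈ S) :: X.filter (· ∉ S) :: Y :: l

open Classical in
/-- The graph of `toggle S` on those lists where it changes the length. -/
inductive Toggles (S : Set ℕ+) : List (Finset ℕ+) → List (Finset ℕ+) → Prop
  | split {X l} (h : ∃ a ∈ X, a ∈ S) (h' : ∃ a ∈ X, a ∉ S) :
    Toggles S (X :: l) (X.filter (· ∈ S) :: X.filter (· ∉ S) :: l)
  | merge {X Y l} (hX : X.Nonempty) (hXS : ∀ a ∈ X, a ∈ S) (hY : Y.Nonempty)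
      (hYS : ∀ a ∈ Y, a ∉ S) : Toggles S (X :: Y :: l) ((X ∪ Y) :: l)
  | cons {X Y Z l l'} (hX : X.Nonempty) (hXS : ∀ a ∈ X, a ∈ S) (hY : ∃ a ∈ Y, a ∈ S) (hZ : ∃ a ∈ Z, a ∈ S)
      (h : Toggles S (Y :: l) (Z :: l')) : Toggles S (X :: Y :: l) (X :: Z :: l')

namespace Toggles

variable {S : Set ℕ+} {l l' : List (Finset ℕ+)}

theorem toggle_eq (h : Toggles S l l') : toggle S l = l' := by
  induction h with
  | @split X l h h' =>
    have : ¬ ∀ a ∈ X, a ∈ S := by simpa using h'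
    cases l <;> rw [toggle, if_neg this]
  | merge hX hXS hY hYS => rw [toggle, if_pos hXS, if_pos hYS]
  | cons hX hXS hY hZ h ih => rw [toggle, if_pos hXS, if_neg (by simpa using hY), ih]

/-- Split and merge undo each other. In the `cons` case, both tails start with a set that meets S,
so neither direction could have merged at that place. -/
theorem symm (h : Toggles S l l') : Toggles S l' l := by
  classical
  induction h with
  | @split X l h h' =>
    have := Toggles.merge (S := S) (X := X.filter (· ∈ S)) (Y := X.filter (· ∉ S)) (l := l)
      (by simpa [Finset.Nonempty] using h) (by simp) (by simpa [Finset.Nonempty] using h')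
      (by simp)
    rwa [Finset.filter_union_filter_not_eq] at this
  | @merge X Y l hX hXS hY hYS =>
    have h1 : (X ∪ Y).filter (· ∈ S) = X := by ext; grind
    have h2 : (X ∪ Y).filter (· ∉ S) = Y := by ext; grind
    have := Toggles.split (S := S) (X := X ∪ Y) (l := l)
      (hX.imp fun a ha => ⟨by simp [ha], hXS a ha⟩) (hY.imp fun a ha => ⟨by simp [ha], hYS a ha⟩)
    rwa [h1, h2] at this
  | cons hX hXS hY hZ h ih => exact ih.cons hX hXS hZ hY

theorem nonempty (h : Toggles S l l') (hl : ∀ X ∈ l, X.Nonempty) : ∀ X ∈ l', X.Nonempty := by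
  classical
  induction h with
  | @split X l h h' =>
    have h1 : (X.filter (· ∈ S)).Nonempty := by simpa [Finset.Nonempty] using h
    have h2 : (X.filter (· ∉ S)).Nonempty := by simpa [Finset.Nonempty] using h'
    simp_all
  | merge hX hXS hY hYS => simp_all
  | cons hX hXS hY hZ h ih => simp_all

theorem exists_mem_iff (h : Toggles S l l') (a : ℕ+) :
    (∃ X ∈ l', a ∈ X) ↔ ∃ X ∈ l, a ∈ X := by
  classical
  induction h with
  | @split X l h h' =>
    simp only [List.exists_mem_cons_iff, Finset.mem_filter]
    tauto
  | merge hX hXS hY hYS => simp [or_assoc]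
  | cons hX hXS hY hZ h ih =>
    rw [List.exists_mem_cons_iff, ih, List.exists_mem_cons_iff (a := _) (l := _ :: _)]

theorem disjoint (h : Toggles S l l') (hl : l.Pairwise Disjoint) : l'.Pairwise Disjoint := by
  classical
  induction h with
  | @split X l h h' =>
    simp only [List.pairwise_cons, List.mem_cons, forall_eq_or_imp] at hl ⊢
    refine ⟨⟨Finset.disjoint_filter_filter_not _ _ _, fun Y hY => ?_⟩, fun Y hY => ?_, hl.2⟩
    · exact (hl.1 Y hY).mono_left (Finset.filter_subset _ _)
    · exact (hl.1 Y hY).mono_left (Finset.filter_subset _ _)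
  | merge hX hXS hY hYS =>
    simp only [List.pairwise_cons, List.mem_cons, forall_eq_or_imp] at hl ⊢
    exact ⟨fun Y hY => Finset.disjoint_union_left.2 ⟨hl.1.2 Y hY, hl.2.1 Y hY⟩, hl.2.2⟩
  | @cons X Y Z l l' hX hXS hY hZ h ih =>
    rw [List.pairwise_cons] at hl ⊢
    refine ⟨fun W hW => Finset.disjoint_left.2 fun a ha ha' => ?_, ih hl.2⟩
    obtain ⟨W', hW', h'⟩ := (h.exists_mem_iff a).1 ⟨W, hW, ha'⟩
    exact Finset.disjoint_left.1 (hl.1 W' hW') ha h'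

theorem resList_eq (h : Toggles S l l') : resList S l' = resList S l := by
  classical
  induction h with
  | @split X l h h' => simp [resList_cons, Finset.filter_filter]
  | @merge X Y l hX hXS hY hYS =>
    have h1 : (X ∪ Y).filter (· ∈ S) = X := by ext; grind
    have h2 : Y.filter (· ∈ S) = ∅ := by ext; grind
    have h3 : X.filter (· ∈ S) = X := by ext; grind
    simp [resList_cons, h1, h2, h3]
  | cons hX hXS hY hZ h ih => rw [resList_cons, ih, ← resList_cons]

theorem resList_compl_eq (h : Toggles S l l') : resList Sᶜ l' = resList Sᶜ l := by
  classical
  induction h with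
  | @split X l h h' => simp [resList_cons, Finset.filter_filter]
  | @merge X Y l hX hXS hY hYS =>
    have h1 : (X ∪ Y).filter (· ∉ S) = Y := by ext; grind
    have h2 : Y.filter (· ∉ S) = Y := by ext; grind
    have h3 : X.filter (· ∉ S) = ∅ := by ext; grind
    simp [resList_cons, h1, h2, h3]
  | cons hX hXS hY hZ h ih => rw [resList_cons, ih, ← resList_cons]

theorem exists_mem_head_iff (h : Toggles S l l') {a : ℕ+} (ha : a ∈ S) :
    (∃ X ∈ l'.head?, a ∈ X) ↔ ∃ X ∈ l.head?, a ∈ X := by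
  cases h with
  | split h h' => simp [ha]
  | merge hX hXS hY hYS =>
    simp only [List.head?_cons, Option.mem_some_iff, exists_eq_left', Finset.mem_union]
    grind
  | cons hX hXS hY hZ h => simp

theorem length_eq (h : Toggles S l l') : l'.length = l.length + 1 ∨ l.length = l'.length + 1 := by
  induction h with
  | split h h' => simp
  | merge hX hXS hY hYS => simp
  | cons hX hXS hY hZ h ih => simpa using ih

theorem exists_mem_head (h : Toggles S l l') : ∃ X ∈ l'.head?, ∃ a ∈ X, a ∈ S := by
  cases h with
  | split h h' => simpa using h
  | merge hX hXS hY hYS =>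
    obtain ⟨a, ha⟩ := hX
    exact ⟨_, rfl, a, by simp [ha], hXS a ha⟩
  | @cons X Y Z l l' hX hXS hY hZ h =>
    obtain ⟨a, ha⟩ := hX
    exact ⟨_, rfl, a, ha, hXS a ha⟩

/-- The first set not contained in S is either split or, being disjoint from S, merged with its
predecessor, which lies in S. The head meeting S guarantees that this predecessor exists. -/
theorem of_head : ∀ (l : List (Finset ℕ+)), (∀ X ∈ l, X.Nonempty) →
    (∃ X ∈ l.head?, ∃ a ∈ X, a ∈ S) → (∃ X ∈ l, ∃ a ∈ X, a ∉ S) → Toggles S l (toggle S l)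
  | [], _, h, _ => by simp at h
  | [X], hl, h, h' => by
    have : ¬ ∀ a ∈ X, a ∈ S := by simpa using h'
    rw [toggle, if_neg this]
    exact split (by simpa using h) (by simpa using h')
  | X :: Y :: l, hl, h, h' => by
    by_cases h1 : ∀ a ∈ X, a ∈ S
    · by_cases h2 : ∀ a ∈ Y, a ∉ S
      · rw [toggle, if_pos h1, if_pos h2]
        exact merge (hl X (by simp)) h1 (hl Y (by simp)) h2
      · rw [toggle, if_pos h1, if_neg h2]
        push Not at h2
        have h3 : ∃ Z ∈ Y :: l, ∃ a ∈ Z, a ∉ S := by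
          rw [List.exists_mem_cons_iff] at h'
          exact h'.resolve_left (by simpa using h1)
        have ih := of_head (Y :: l) (fun Z hZ => hl Z (List.mem_cons_of_mem _ hZ)) (by simpa) h3
        have h4 := ih.exists_mem_head
        cases htog : toggle S (Y :: l) with
        | nil => simp [htog] at h4
        | cons Z l' =>
          rw [htog] at ih h4
          exact cons (hl X (by simp)) h1 h2 (by simpa using h4) ih
    · rw [toggle, if_neg h1]
      exact split (by simpa using h) (by simpa using h1)

end Toggles

/-- The effect of `toggle S` on set compositions. -/
noncomputable def toggleComp (S : Set ℕ+) (R : SetComp)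
    (h : Toggles S R.parts (toggle S R.parts)) : SetComp where
  parts := toggle S R.parts
  nonempty := h.nonempty R.nonempty
  disjoint := h.disjoint R.disjoint

/-- Toggling changes the length by one, hence the sign, and preserves the restrictions to S and Sᶜ.
Since b ∈ S, it also keeps b in the first component, so the terms of the coproduct cancel in pairs.
-/
theorem cop_eSet_eq_zero {S : Set ℕ+} {B : Finset ℕ+} {b : ℕ+} (hb : IsLeast (B : Set ℕ+) b)
    (hbS : b ∈ S) (h : ∃ a ∈ B, a ∉ S) : cop F S (eSet F B) = 0 := by
  classical
  have key : ∀ P : On B, P.1.IsStar → Toggles S P.1.parts (toggle S P.1.parts) := by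
    rintro ⟨P, rfl⟩ ⟨X, hX, a, ha, hmin⟩
    obtain rfl := hmin.unique hb
    obtain ⟨c, hc, hcS⟩ := h
    obtain ⟨Y, hY, hcY⟩ := mem_support.1 hc
    exact .of_head _ P.nonempty ⟨X, hX, a, ha, hbS⟩ ⟨Y, hY, c, hcY, hcS⟩
  have hsupp : ∀ (P : On B) (hP : P.1.IsStar), (toggleComp S P.1 (key P hP)).support = B := by
    intro P hP
    conv_rhs => rw [← P.2]
    ext a
    rw [mem_support, mem_support]
    exact (key P hP).exists_mem_iff a
  rw [eSet, map_sum]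
  refine Finset.sum_involution
    (fun P hP => ⟨toggleComp S P.1 (key P (Finset.mem_filter.1 hP).2), hsupp P (Finset.mem_filter.1 hP).2⟩) ?_ ?_ ?_ ?_
  · intro P hP
    have hP' := key P (Finset.mem_filter.1 hP).2
    have h1 : res S (toggleComp S P.1 hP') = res S P.1 := SetComp.ext hP'.resList_eq
    have h2 : res Sᶜ (toggleComp S P.1 hP') = res Sᶜ P.1 := SetComp.ext hP'.resList_compl_eq
    rw [cop_single, cop_single, h1, h2, ← add_smul]
    -- Both lengths must be positive for the truncated exponents `length - 1` to differ by exactly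
    -- one.
    have h4 : 0 < P.1.length := by
      obtain ⟨X, hX, -⟩ := (Finset.mem_filter.1 hP).2
      exact List.length_pos_of_mem (List.mem_of_mem_head? hX)
    have h5 : 0 < (toggleComp S P.1 hP').length := by
      obtain ⟨X, hX, -⟩ := hP'.exists_mem_head
      exact List.length_pos_of_mem (List.mem_of_mem_head? hX)
    have h6 : ((-1 : F) ^ (P.1.length - 1) + (-1) ^ ((toggleComp S P.1 hP').length - 1)) = 0 := by
      obtain h | h : (toggleComp S P.1 hP').length - 1 = P.1.length - 1 + 1 ∨
          P.1.length - 1 = (toggleComp S P.1 hP').length - 1 + 1 := by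
        have h7 : (toggleComp S P.1 hP').length = P.1.length + 1 ∨
          P.1.length = (toggleComp S P.1 hP').length + 1 := hP'.length_eq
        omega
      · rw [h, pow_succ]; ring
      · rw [h, pow_succ]; ring
    rw [h6, zero_smul]
  · intro P hP _ heq
    have hP' := key P (Finset.mem_filter.1 hP).2
    have := congrArg (fun Q : On B => Q.1.parts.length) heq
    have h7 := hP'.length_eq
    simp only [toggleComp] at this
    omega
  · intro P hP
    have hP' := key P (Finset.mem_filter.1 hP).2
    refine Finset.mem_filter.2 ⟨Finset.mem_univ _, ?_⟩
    obtain ⟨X, hX, a, ha, hmin⟩ := (Finset.mem_filter.1 hP).2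
    rw [P.2] at hmin
    obtain rfl := hmin.unique hb
    obtain ⟨Y, hY, haY⟩ := (hP'.exists_mem_head_iff hbS).2 ⟨X, hX, ha⟩
    exact ⟨Y, hY, a, haY, by rw [hsupp P (Finset.mem_filter.1 hP).2]; exact hb⟩
  · intro P hP
    have hP' := key P (Finset.mem_filter.1 hP).2
    exact Subtype.ext (SetComp.ext hP'.symm.toggle_eq)

/-- Exchanging the tensor factors exchanges S and Sᶜ; this allows the assumption min B ∈ S in the
proof of primitivity. -/
theorem cop_compl_eq_zero {S : Set ℕ+} {f : FPi F} (h : cop F Sᶜ f = 0) : cop F S f = 0 := by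
  have key : ∀ f : FPi F, TensorProduct.comm F _ _ (cop F Sᶜ f) = cop F S f := by
    intro f
    induction f using Finsupp.induction_linear with
    | zero => simp
    | add f g hf hg => rw [map_add, map_add, hf, hg, map_add]
    | single R a => simp
  rw [← key, h, map_zero]

theorem isPrim_eSet (B : Finset ℕ+) : IsPrim B (eSet F B) := by
  refine ⟨eSet_mem_graded B, fun S ⟨a, ha, haS⟩ hS' => ?_⟩
  have hb : IsLeast (B : Set ℕ+) (B.min' ⟨a, ha⟩) := B.isLeast_min' ⟨a, ha⟩
  by_cases h : B.min' ⟨a, ha⟩ ∈ S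
  · exact cop_eSet_eq_zero hb h hS'
  · exact cop_compl_eq_zero (cop_eSet_eq_zero hb h ⟨a, ha, by simpa using haS⟩)

/-! ### Lie monomials with the minimum in the last place -/

/-- The right-normed Lie monomial `e_{X₁} ∘ (e_{X₂} ∘ (⋯ ∘ e_{X_k}))`. -/
noncomputable def brk (F : Type*) [Field F] : List (Finset ℕ+) → FPi F
  | [] => 0
  | [X] => eSet F X
  | X :: Y :: l => lie F (eSet F X) (brk F (Y :: l))

theorem brk_cons {l : List (Finset ℕ+)} (h : l ≠ []) (X : Finset ℕ+) :
    brk F (X :: l) = lie F (eSet F X) (brk F l) := by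
  cases l with
  | nil => exact absurd rfl h
  | cons Y l => rfl

theorem eLin_dynkin : ∀ (l : List (Finset ℕ+)) (h : ∀ X ∈ l, X.Nonempty),
    eLin F (dynkin F l h) = brk F l
  | [], _ => by simp [dynkin, brk]
  | [X], h => by simp [dynkin, brk, eComp, SetComp.single, veeProd_cons, veeProd_nil]
  | X :: Y :: l, h => by
    rw [dynkin, brk, lie, map_sub, eLin_vee, eLin_vee, eLin_dynkin (Y :: l)]
    simp [lie, eComp, SetComp.single, veeProd_cons, veeProd_nil]

theorem eLin_circ (R : SetComp) : eLin F (circ F R) = brk F R.parts :=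
  eLin_dynkin _ _

theorem isPrim_brk : ∀ l : List (Finset ℕ+), IsPrim (l.foldr (· ∪ ·) ∅) (brk F l)
  | [] => ⟨zero_mem _, fun S _ _ => map_zero _⟩
  | [X] => by simpa [brk] using isPrim_eSet X
  | X :: Y :: l => (isPrim_eSet X).lie (isPrim_brk (Y :: l))

/-- The span of the right-normed Lie monomials of length `n` in the elements `e_X` such that
the sets `X` form a set composition of `B` and the last of them contains `min B`. -/
noncomputable def lieSpan (F : Type*) [Field F] (B : Finset ℕ+) (n : ℕ) : Submodule F (FPi F) :=
  Submodule.span F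
    {f | ∃ R : SetComp, R.IsDagger ∧ R.support = B ∧ R.length = n ∧ brk F R.parts = f}

theorem brk_mem_lieSpan {R : SetComp} (h : R.IsDagger) :
    brk F R.parts ∈ lieSpan F R.support R.length :=
  Submodule.subset_span ⟨R, h, rfl, rfl, rfl⟩

theorem SetComp.IsDagger.parts_ne_nil {R : SetComp} (h : R.IsDagger) : R.parts ≠ [] := by
  obtain ⟨X, hX, -⟩ := h
  rintro h'
  simp [h'] at hX

theorem SetComp.IsDagger.support_nonempty {R : SetComp} (h : R.IsDagger) : R.support.Nonempty := by
  obtain ⟨X, -, a, -, ha⟩ := h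
  exact ⟨a, ha.1⟩

theorem lie_eSet_mem_lieSpan {X C : Finset ℕ+} {p : ℕ} {f : FPi F} (hX : X.Nonempty)
    (hXC : Disjoint X C) (hmin : ∃ c ∈ C, ∀ x ∈ X, c ≤ x) (hf : f ∈ lieSpan F C p) :
    lie F (eSet F X) f ∈ lieSpan F (X ∪ C) (p + 1) := by
  induction hf using Submodule.span_induction with
  | mem f h =>
    obtain ⟨R, hR, rfl, rfl, rfl⟩ := h
    rw [← brk_cons hR.parts_ne_nil]
    refine Submodule.subset_span ⟨append (SetComp.single X hX) R (by simpa using hXC), ?_, ?_,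
      rfl, rfl⟩
    · obtain ⟨Y, hY, a, haY, ha⟩ := hR
      obtain ⟨c, hc, hcX⟩ := hmin
      have hY' : R.parts.getLast? = some Y := hY
      refine ⟨Y, by simp [append, List.getLast?_append, hY'], a, haY, ?_⟩
      rw [support_append, SetComp.support_single, Finset.coe_union]
      refine ⟨Or.inr ha.1, fun x hx => hx.elim (fun hx => ?_) (fun hx => ha.2 hx)⟩
      exact (ha.2 hc).trans (hcX x hx)
    · simp
  | zero => simp [lie]
  | add x y _ _ hx hy =>
    have : lie F (eSet F X) (x + y) = lie F (eSet F X) x + lie F (eSet F X) y := by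
      simp only [lie, map_add, LinearMap.add_apply]; abel
    rw [this]
    exact add_mem hx hy
  | smul a x _ hx =>
    have : lie F (eSet F X) (a • x) = a • lie F (eSet F X) x := by
      simp only [lie, map_smul, LinearMap.smul_apply, smul_sub]
    rw [this]
    exact Submodule.smul_mem _ _ hx

/-- The Jacobi identity [[X, g], f] = [X, [g, f]] - [g, [X, f]] peels off the first letter X. In the
second term [X, f] takes the role of f, so the induction must let f, its support C and its length p
vary. -/
theorem lie_brk_mem_lieSpan {l : List (Finset ℕ+)} (hl : l ≠ []) (hne : ∀ X ∈ l, X.Nonempty)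
    (hdisj : l.Pairwise Disjoint) {C : Finset ℕ+} {p : ℕ} {f : FPi F}
    (hC : ∀ X ∈ l, Disjoint X C) (hmin : ∃ c ∈ C, ∀ X ∈ l, ∀ x ∈ X, c ≤ x)
    (hf : f ∈ lieSpan F C p) :
    lie F (brk F l) f ∈ lieSpan F (l.foldr (· ∪ ·) ∅ ∪ C) (p + l.length) := by
  induction l generalizing C p f with
  | nil => exact absurd rfl hl
  | cons X l ih =>
    have hX := hne X (by simp)
    have hXC := hC X (by simp)
    obtain ⟨c, hc, hcl⟩ := hmin
    have hcX := hcl X (by simp)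
    have heX := lie_eSet_mem_lieSpan hX hXC ⟨c, hc, hcX⟩ hf
    rcases eq_or_ne l [] with rfl | hl'
    · simpa [brk] using heX
    · rw [List.pairwise_cons] at hdisj
      have hne' : ∀ Y ∈ l, Y.Nonempty := fun Y hY => hne Y (by simp [hY])
      have hcl' : ∀ Y ∈ l, ∀ x ∈ Y, c ≤ x := fun Y hY => hcl Y (by simp [hY])
      have hC' : ∀ Y ∈ l, Disjoint Y C := fun Y hY => hC Y (by simp [hY])
      rw [brk_cons hl', lie_lie]
      refine sub_mem ?_ ?_
      · have h1 := ih hl' hne' hdisj.2 hC' ⟨c, hc, hcl'⟩ hf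
        have h2 := lie_eSet_mem_lieSpan hX (Finset.disjoint_union_right.2 ⟨?_, hXC⟩)
          ⟨c, Finset.mem_union_right _ hc, hcX⟩ h1
        · simpa [Finset.union_assoc, add_assoc] using h2
        · refine Finset.disjoint_left.2 fun a ha ha' => ?_
          obtain ⟨Y, hY, haY⟩ := mem_foldr_union.1 ha'
          exact Finset.disjoint_left.1 (hdisj.1 Y hY) ha haY
      · have h1 := ih hl' hne' hdisj.2 (C := X ∪ C)
          (fun Y hY => Finset.disjoint_union_right.2 ⟨(hdisj.1 Y hY).symm, hC' Y hY⟩)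
          ⟨c, Finset.mem_union_right _ hc, hcl'⟩ heX
        have h2 : List.foldr (· ∪ ·) ∅ (X :: l) ∪ C = List.foldr (· ∪ ·) ∅ l ∪ (X ∪ C) := by
          simp only [List.foldr_cons]
          ac_rfl
        rw [h2, List.length_cons, add_comm l.length, ← add_assoc]
        exact h1

theorem lie_brk_brk_mem_lieSpan {R R' : SetComp} (hR : R.IsDagger) (hR' : R'.IsDagger)
    (h : Disjoint R.support R'.support) :
    lie F (brk F R.parts) (brk F R'.parts) ∈
      lieSpan F (R.support ∪ R'.support) (R.length + R'.length) := by
  have key : ∀ {R R' : SetComp} {c : ℕ+}, R.IsDagger → R'.IsDagger →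
      Disjoint R.support R'.support → c ∈ R'.support → (∀ x ∈ R.support, c ≤ x) →
      lie F (brk F R.parts) (brk F R'.parts) ∈
        lieSpan F (R.support ∪ R'.support) (R'.length + R.length) := by
    intro R R' c hR hR' h hc hmin
    exact lie_brk_mem_lieSpan hR.parts_ne_nil R.nonempty R.disjoint
      (fun X hX => h.mono_left fun a ha => mem_support.2 ⟨X, hX, ha⟩)
      ⟨c, hc, fun X hX x hx => hmin x (mem_support.2 ⟨X, hX, hx⟩)⟩ (brk_mem_lieSpan hR')
  have hR1 := hR
  have hR2 := hR'
  obtain ⟨-, -, a, -, ha⟩ := hR1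
  obtain ⟨-, -, b, -, hb⟩ := hR2
  -- By antisymmetry the monomial with the smaller minimum may stand on the right, where its last
  -- letter stays last.
  rcases le_total a b with hab | hab
  · rw [lie_antisymm, Finset.union_comm]
    exact neg_mem (key hR' hR h.symm ha.1 fun x hx => hab.trans (hb.2 hx))
  · rw [add_comm]
    exact key hR hR' h hb.1 fun x hx => hab.trans (ha.2 hx)

/-! ### Products of Lie monomials and the degree filtration -/

/-- `L` is a sequence of elements of `Π^†` whose supports form a set composition of `A`. -/
structure IsFact (A : Finset ℕ+) (L : List SetComp) : Prop where
  dagger : ∀ R ∈ L, R.IsDagger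
  disjoint : L.Pairwise fun R R' => Disjoint R.support R'.support
  mem_iff : ∀ a, a ∈ A ↔ ∃ R ∈ L, a ∈ R.support

/-- The sum of the numbers `ℓ(R) - 1`. -/
def factDeg (L : List SetComp) : ℕ := (L.map fun R => R.length - 1).sum

/-- The product of the Lie monomials `e_{R°}`. -/
noncomputable def factProd (F : Type*) [Field F] (L : List SetComp) : FPi F :=
  veeProd F (L.map fun R => brk F R.parts)

theorem factProd_append (L L' : List SetComp) :
    factProd F (L ++ L') = vee F (factProd F L) (factProd F L') := by
  simp [factProd, veeProd_append]

theorem factProd_cons (R : SetComp) (L : List SetComp) :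
    factProd F (R :: L) = vee F (brk F R.parts) (factProd F L) := rfl

theorem factProd_nil : factProd F [] = veeOne F := rfl

theorem factDeg_perm {L L' : List SetComp} (h : L.Perm L') : factDeg L = factDeg L' :=
  (h.map _).sum_eq

theorem SetComp.length_le_card_support (Q : SetComp) : Q.length ≤ Q.support.card := by
  obtain ⟨l, hl, hd⟩ := Q
  change l.length ≤ (l.foldr (· ∪ ·) ∅).card
  induction l with
  | nil => simp
  | cons X l ih =>
    rw [List.pairwise_cons] at hd
    rw [List.foldr_cons, Finset.card_union_of_disjoint, List.length_cons]
    · have := (hl X (by simp)).card_pos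
      have := ih (fun Y hY => hl Y (by simp [hY])) hd.2
      omega
    · refine Finset.disjoint_left.2 fun a ha ha' => ?_
      obtain ⟨Y, hY, haY⟩ := mem_foldr_union.1 ha'
      exact Finset.disjoint_left.1 (hd.1 Y hY) ha haY

namespace IsFact

variable {A : Finset ℕ+} {L L' : List SetComp}

theorem perm (h : IsFact A L) (hL : L.Perm L') : IsFact A L' where
  dagger R hR := h.dagger R (hL.mem_iff.2 hR)
  disjoint := (hL.pairwise_iff fun h => Disjoint.symm h).1 h.disjoint
  mem_iff a := by simp only [h.mem_iff a, hL.mem_iff]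

theorem subset (h : IsFact A L) {R : SetComp} (hR : R ∈ L) : R.support ⊆ A :=
  fun a ha => (h.mem_iff a).2 ⟨R, hR, ha⟩

/-- The concatenation of the factors. -/
def total (h : IsFact A L) : SetComp where
  parts := (L.map SetComp.parts).flatten
  nonempty X hX := by
    obtain ⟨R, hR, hX⟩ : ∃ R ∈ L, X ∈ R.parts := by simpa using hX
    exact R.nonempty X hX
  disjoint := by
    refine List.pairwise_flatten.2 ⟨by simpa using fun R _ => R.disjoint, ?_⟩
    refine List.pairwise_map.2 (h.disjoint.imp fun {R R'} h X hX Y hY => ?_)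
    exact Finset.disjoint_left.2 fun a ha hb => Finset.disjoint_left.1 h
      (mem_support.2 ⟨X, hX, ha⟩) (mem_support.2 ⟨Y, hY, hb⟩)

theorem support_total (h : IsFact A L) : h.total.support = A := by
  ext a
  rw [h.mem_iff, mem_support]
  simp only [total, List.mem_flatten, List.mem_map, mem_support]
  grind

theorem length_flatten (h : ∀ R ∈ L, R.IsDagger) :
    (L.map SetComp.parts).flatten.length = L.length + factDeg L := by
  induction L with
  | nil => rfl
  | cons R L ih =>
    have h1 := ih fun R hR => h R (by simp [hR])
    have h2 : 0 < R.parts.length := List.length_pos_of_ne_nil (h R (by simp)).parts_ne_nil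
    simp only [factDeg, SetComp.length, List.map_cons, List.flatten_cons, List.length_append,
      List.length_cons, List.sum_cons] at h1 ⊢
    omega

theorem length_total (h : IsFact A L) : h.total.length = L.length + factDeg L :=
  length_flatten h.dagger

theorem factDeg_le (h : IsFact A L) : factDeg L ≤ A.card := by
  have h1 := h.length_total
  have h2 := h.total.length_le_card_support
  rw [h.support_total] at h2
  omega

end IsFact

/-- The span of the products of Lie monomials of degree at least `k`. -/
noncomputable def filt (F : Type*) [Field F] (A : Finset ℕ+) (k : ℕ) : Submodule F (FPi F) :=
  Submodule.span F {f | ∃ L, IsFact A L ∧ k ≤ factDeg L ∧ factProd F L = f}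

/-- The minima of the supports of the factors are increasing. -/
def IsSortedFact (L : List SetComp) : Prop :=
  L.Pairwise fun R R' => R.support.min < R'.support.min

/-- The span of the products of Lie monomials of degree at least `k` where the minima of the
supports of the factors are increasing. -/
noncomputable def sortedFilt (F : Type*) [Field F] (A : Finset ℕ+) (k : ℕ) : Submodule F (FPi F) :=
  Submodule.span F
    {f | ∃ L, IsFact A L ∧ IsSortedFact L ∧ k ≤ factDeg L ∧ factProd F L = f}

theorem factProd_mem_filt {A : Finset ℕ+} {L : List SetComp} (h : IsFact A L) {k : ℕ}
    (hk : k ≤ factDeg L) : factProd F L ∈ filt F A k :=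
  Submodule.subset_span ⟨L, h, hk, rfl⟩

theorem factProd_mem_sortedFilt {A : Finset ℕ+} {L : List SetComp} (h : IsFact A L)
    (hL : IsSortedFact L) {k : ℕ} (hk : k ≤ factDeg L) : factProd F L ∈ sortedFilt F A k :=
  Submodule.subset_span ⟨L, h, hL, hk, rfl⟩

theorem sortedFilt_anti (A : Finset ℕ+) {k k' : ℕ} (h : k ≤ k') :
    sortedFilt F A k' ≤ sortedFilt F A k :=
  Submodule.span_mono fun _ ⟨L, h1, h1', h2, h3⟩ => ⟨L, h1, h1', h.trans h2, h3⟩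

/-- The difference is the product with the two factors replaced by their bracket. Factors of lengths
p and q contribute (p - 1) + (q - 1) to the degree, a single factor of length p + q contributes p +
q - 1. -/
theorem factProd_swap {A : Finset ℕ+} {L L' : List SetComp} {R R' : SetComp}
    (h : IsFact A (L ++ R :: R' :: L')) :
    factProd F (L ++ R :: R' :: L') - factProd F (L ++ R' :: R :: L') ∈
      filt F A (factDeg (L ++ R :: R' :: L') + 1) := by
  have hR := h.dagger R (by simp)
  have hR' := h.dagger R' (by simp)
  have hd := h.disjoint
  simp only [List.pairwise_append, List.pairwise_cons, List.mem_cons, forall_eq_or_imp] at hd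
  obtain ⟨hd1, ⟨⟨hd2, hd3⟩, hd4, hd5⟩, hd6⟩ := hd
  have h0 : factProd F (L ++ R :: R' :: L') - factProd F (L ++ R' :: R :: L') =
      vee F (factProd F L) (vee F (lie F (brk F R.parts) (brk F R'.parts)) (factProd F L')) := by
    simp only [factProd_append, factProd_cons, lie, map_sub, LinearMap.sub_apply, vee_assoc]
  rw [h0]
  have h1 := lie_brk_brk_mem_lieSpan (F := F) hR hR' hd2
  revert h1
  generalize lie F (brk F R.parts) (brk F R'.parts) = x
  intro hx
  induction hx using Submodule.span_induction with
  | mem x hx =>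
    obtain ⟨Q, hQ, hQs, hQl, rfl⟩ := hx
    rw [← factProd_cons, ← factProd_append]
    refine factProd_mem_filt ⟨?_, ?_, ?_⟩ ?_
    · have := h.dagger
      simp only [List.mem_append, List.mem_cons] at this ⊢
      grind
    · simp only [List.pairwise_append, List.pairwise_cons, List.mem_cons, forall_eq_or_imp, hQs,
        Finset.disjoint_union_left, Finset.disjoint_union_right]
      exact ⟨hd1, ⟨fun P hP => ⟨hd3 P hP, hd4 P hP⟩, hd5⟩,
        fun P hP => ⟨⟨(hd6 P hP).1, (hd6 P hP).2.1⟩, (hd6 P hP).2.2⟩⟩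
    · intro a
      rw [h.mem_iff]
      simp only [List.mem_append, List.mem_cons, or_and_right, exists_or, exists_eq_left, hQs,
        Finset.mem_union, or_assoc]
    · have h2 : 0 < R.length := List.length_pos_of_ne_nil hR.parts_ne_nil
      have h3 : 0 < R'.length := List.length_pos_of_ne_nil hR'.parts_ne_nil
      simp only [factDeg, List.map_append, List.map_cons, List.sum_append, List.sum_cons]
      omega
  | zero => simp
  | add x y _ _ hx hy => simpa using add_mem hx hy
  | smul a x _ hx => simpa using Submodule.smul_mem _ a hx

/-- The prefix K is there for the induction on permutations: a common first factor is moved into it.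
-/
theorem factProd_perm_append {A : Finset ℕ+} {L L' : List SetComp} (hL : L.Perm L') :
    ∀ K : List SetComp, IsFact A (K ++ L) →
      factProd F (K ++ L) - factProd F (K ++ L') ∈ filt F A (factDeg (K ++ L) + 1) := by
  induction hL with
  | nil => simp
  | @cons R L L' _ ih =>
    intro K hK
    simpa using ih (K ++ [R]) (by simpa using hK)
  | swap R R' L => exact fun K hK => factProd_swap hK
  | @trans L₁ L₂ L₃ h₁ h₂ ih₁ ih₂ =>
    intro K hK
    have h1 := ih₁ K hK
    have h2 := ih₂ K (hK.perm (h₁.append_left K))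
    rw [← factDeg_perm (h₁.append_left K)] at h2
    simpa using add_mem h1 h2

theorem factProd_perm {A : Finset ℕ+} {L L' : List SetComp} (h : IsFact A L) (hL : L.Perm L') :
    factProd F L - factProd F L' ∈ filt F A (factDeg L + 1) :=
  factProd_perm_append hL [] h

theorem IsFact.exists_sorted {A : Finset ℕ+} {L : List SetComp} (h : IsFact A L) :
    ∃ L', L.Perm L' ∧ IsSortedFact L' := by
  classical
  let r : SetComp → SetComp → Prop := fun R R' => R.support.min ≤ R'.support.min
  have : Std.Total r := ⟨fun R R' => le_total _ _⟩
  have : IsTrans SetComp r := ⟨fun _ _ _ h h' => le_trans h h'⟩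
  have hp := L.perm_insertionSort r
  refine ⟨L.insertionSort r, hp.symm, ?_⟩
  have h' := h.perm hp.symm
  refine ((List.pairwise_insertionSort r L).and h'.disjoint).imp_of_mem ?_
  rintro R R' hR hR' ⟨h1, h2⟩
  refine lt_of_le_of_ne h1 fun heq => ?_
  obtain ⟨a, ha⟩ := Finset.min_of_nonempty (h'.dagger R hR).support_nonempty
  exact Finset.disjoint_left.1 h2 (Finset.mem_of_min ha) (Finset.mem_of_min (heq ▸ ha))

/-- Sorting the factors costs an error of higher degree, which is handled by downward induction on
the degree. It starts beyond |A|, where no products exist. -/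
theorem filt_le_sortedFilt (A : Finset ℕ+) (k : ℕ) : filt F A k ≤ sortedFilt F A k := by
  by_cases hk : A.card < k
  · refine Submodule.span_le.2 ?_
    rintro _ ⟨L, h, hkL, -⟩
    exact absurd h.factDeg_le (by omega)
  · refine Submodule.span_le.2 ?_
    rintro _ ⟨L, h, hkL, rfl⟩
    obtain ⟨L', hp, hs⟩ := h.exists_sorted
    have h1 := factProd_perm (F := F) h hp
    have h2 := factProd_mem_sortedFilt (F := F) (h.perm hp) hs (hkL.trans (factDeg_perm hp).le)
    have h3 := sortedFilt_anti A (by omega) (filt_le_sortedFilt A (factDeg L + 1) h1)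
      (k := k)
    simpa using add_mem h3 h2
termination_by A.card + 1 - k

/-! ### Left multiplication on products of Lie monomials -/

theorem wedgeList_cons_left (X : Finset ℕ+) (P Q : List (Finset ℕ+)) (h : ∀ Y ∈ P, Disjoint X Y) :
    wedgeList (X :: P) Q = resList (X : Set ℕ+) Q ++ wedgeList P (resList (X : Set ℕ+)ᶜ Q) := by
  classical
  rw [wedgeList, List.flatMap_cons]
  congr 1
  · rw [resList]
    congr 1
    refine List.map_congr_left fun Y _ => ?_
    ext a
    simp [and_comm]
  · refine List.flatMap_congr fun Y hY => ?_
    induction Q with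
    | nil => rfl
    | cons Z Q ih =>
      have hYZ : ∀ _ : DecidablePred (· ∈ (X : Set ℕ+)ᶜ),
          Y ∩ Z.filter (· ∈ (X : Set ℕ+)ᶜ) = Y ∩ Z := by
        intro _
        ext a
        have : a ∈ Y → a ∉ X := fun ha => Finset.disjoint_right.1 (h Y hY) ha
        simp
        tauto
      rw [resList_cons, List.map_cons, List.filter_cons, ih]
      split_ifs with h1 h2 h2
      · rw [← hYZ, h2, Finset.inter_empty] at h1
        simp at h1
      · rw [List.map_cons, List.filter_cons, hYZ, if_pos h1]
      · rfl
      · rw [List.map_cons, List.filter_cons, hYZ, if_neg h1]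

/-- Left multiplication by `P` on `FΠ`. -/
noncomputable def wedgeLeft (F : Type*) [Field F] (P : SetComp) : FPi F →ₗ[F] FPi F :=
  Finsupp.lmapDomain F F (wedge P)

@[simp] theorem wedgeLeft_single (P R : SetComp) (a : F) :
    wedgeLeft F P (Finsupp.single R a) = Finsupp.single (wedge P R) a := by
  simp [wedgeLeft]

/-- The link between the two products: the intersections with X form the restriction to X, and the
later components, being disjoint from X, only see the restriction to its complement. -/
theorem wedgeLeft_cons {X : Finset ℕ+} {l : List (Finset ℕ+)} (hne : ∀ Y ∈ X :: l, Y.Nonempty)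
    (hd : (X :: l).Pairwise Disjoint) (f : FPi F) :
    wedgeLeft F ⟨X :: l, hne, hd⟩ f =
      TensorProduct.lift (vee F) (TensorProduct.map LinearMap.id
        (wedgeLeft F ⟨l, fun Y hY => hne Y (List.mem_cons_of_mem _ hY), hd.of_cons⟩)
          (cop F (X : Set ℕ+) f)) := by
  induction f using Finsupp.induction_linear with
  | zero => simp
  | add f g hf hg => simp only [map_add, hf, hg]
  | single R a =>
    simp only [cop_single, map_smul, TensorProduct.map_tmul, TensorProduct.lift.tmul,
      LinearMap.id_apply, wedgeLeft_single, vee_single, mul_one]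
    rw [dif_pos]
    · rw [Finsupp.smul_single, smul_eq_mul, mul_one]
      congr 1
      exact SetComp.ext (wedgeList_cons_left X l R.parts (List.pairwise_cons.1 hd).1)
    · refine Finset.disjoint_left.2 fun a ha hb => ?_
      rw [support_wedge, Finset.mem_inter, mem_support_res] at hb
      exact hb.2.2 (mem_support_res.1 ha).2

theorem cop_factProd_eq_zero {S : Set ℕ+} {L : List SetComp}
    (h : ∃ R ∈ L, (∃ a ∈ R.support, a ∈ S) ∧ ∃ a ∈ R.support, a ∉ S) :
    cop F S (factProd F L) = 0 := by
  obtain ⟨R, hR, h1, h2⟩ := h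
  obtain ⟨K, K', rfl⟩ := List.append_of_mem hR
  have : cop F S (brk F R.parts) = 0 := (isPrim_brk R.parts).2 S h1 h2
  simp [factProd_append, factProd_cons, cop_vee, this]

/-- The coproduct is multiplicative and no factor is cut by X, so each factor goes wholly to one
side, in the given order. -/
theorem cop_factProd {X : Finset ℕ+} {L : List SetComp} (hne : ∀ R ∈ L, R.support.Nonempty)
    (h : ∀ R ∈ L, R.support ⊆ X ∨ Disjoint R.support X) :
    cop F (X : Set ℕ+) (factProd F L) =
      factProd F (L.filter fun R => R.support ⊆ X) ⊗ₜ
        factProd F (L.filter fun R => ¬ R.support ⊆ X) := by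
  induction L with
  | nil =>
    exact cop_eq_tmul_one (B := ∅) veeOne_mem_graded (by simp)
  | cons R L ih =>
    have ih := ih (fun Q hQ => hne Q (by simp [hQ])) (fun Q hQ => h Q (by simp [hQ]))
    rw [factProd_cons, cop_vee, ih]
    by_cases h1 : R.support ⊆ X
    · rw [List.filter_cons_of_pos (by simpa using h1), List.filter_cons_of_neg (by simpa using h1),
        cop_eq_tmul_one (isPrim_brk R.parts).1 (fun a ha => h1 ha), factProd_cons]
      simp [TensorProduct.map₂_apply_tmul]
    · have h2 := (h R (by simp)).resolve_left h1
      rw [List.filter_cons_of_neg (by simpa using h1), List.filter_cons_of_pos (by simpa using h1),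
        cop_eq_one_tmul (isPrim_brk R.parts).1 (fun a ha => Finset.disjoint_left.1 h2 ha),
        factProd_cons]
      simp [TensorProduct.map₂_apply_tmul]

/-- Every factor is supported in one of the components of `P`. -/
def Fits (P : SetComp) (L : List SetComp) : Prop := ∀ R ∈ L, ∃ X ∈ P.parts, R.support ⊆ X

/-- The factors of `L`, stably sorted by the components of `P` that contain them. -/
def sortBy (P : SetComp) (L : List SetComp) : List SetComp :=
  P.parts.flatMap fun X => L.filter fun R => R.support ⊆ X

/-- Induction on the components of P. The coproduct at the first component X vanishes if X cuts a
factor; otherwise it puts the factors inside X in front and leaves the others to the remaining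
components. -/
theorem wedgeLeft_factProd_aux : ∀ (l : List (Finset ℕ+)) (hne : ∀ Y ∈ l, Y.Nonempty)
    (hd : l.Pairwise Disjoint) (L : List SetComp), (∀ R ∈ L, R.support.Nonempty) →
    (∀ R ∈ L, R.support ⊆ l.foldr (· ∪ ·) ∅) →
    (Fits ⟨l, hne, hd⟩ L → wedgeLeft F ⟨l, hne, hd⟩ (factProd F L) =
      factProd F (sortBy ⟨l, hne, hd⟩ L)) ∧
    (¬ Fits ⟨l, hne, hd⟩ L → wedgeLeft F ⟨l, hne, hd⟩ (factProd F L) = 0)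
  | [], hne, hd, L, hL, hsub => by
    have : L = [] := by
      rw [List.eq_nil_iff_forall_not_mem]
      intro R hR
      obtain ⟨a, ha⟩ := hL R hR
      simpa using hsub R hR ha
    subst this
    refine ⟨fun _ => ?_, fun h => absurd (by simp [Fits]) h⟩
    rw [factProd_nil, veeOne, wedgeLeft_single]
    rfl
  | X :: l, hne, hd, L, hL, hsub => by
    rw [wedgeLeft_cons]
    have hX := (List.pairwise_cons.1 hd).1
    by_cases h : ∃ R ∈ L, (∃ a ∈ R.support, a ∈ (X : Set ℕ+)) ∧ ∃ a ∈ R.support, a ∉ (X : Set ℕ+)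
    · rw [cop_factProd_eq_zero h]
      refine ⟨fun hfit => ?_, fun _ => by simp⟩
      obtain ⟨R, hR, ⟨a, ha, haX⟩, b, hb, hbX⟩ := h
      obtain ⟨Y, hY, hRY⟩ := hfit R hR
      rcases List.mem_cons.1 hY with rfl | hY
      · exact absurd (hRY hb) hbX
      · exact absurd (hRY ha) (Finset.disjoint_left.1 (hX Y hY) haX)
    · have h' : ∀ R ∈ L, R.support ⊆ X ∨ Disjoint R.support X := by
        intro R hR
        by_contra hc
        push Not at hc
        obtain ⟨b, hb, hbX⟩ := Finset.not_subset.1 hc.1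
        obtain ⟨a, ha, haX⟩ := Finset.not_disjoint_iff.1 hc.2
        exact h ⟨R, hR, ⟨a, ha, haX⟩, b, hb, hbX⟩
      rw [cop_factProd hL h']
      have ih := wedgeLeft_factProd_aux l (fun Y hY => hne Y (List.mem_cons_of_mem _ hY))
        hd.of_cons (L.filter fun R => ¬ R.support ⊆ X)
        (fun R hR => hL R (List.mem_of_mem_filter hR)) (by
          intro R hR a ha
          have hR1 := List.mem_filter.1 hR
          have hR2 : ¬ R.support ⊆ X := by simpa using hR1.2
          have h3 := hsub R hR1.1 ha
          rw [List.foldr_cons, Finset.mem_union] at h3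
          exact h3.resolve_left (Finset.disjoint_left.1 ((h' R hR1.1).resolve_left hR2) ha))
      have hfit : Fits ⟨X :: l, hne, hd⟩ L ↔
          Fits ⟨l, fun Y hY => hne Y (List.mem_cons_of_mem _ hY), hd.of_cons⟩
            (L.filter fun R => ¬ R.support ⊆ X) := by
        simp only [Fits, List.mem_filter, List.mem_cons, exists_eq_or_imp, decide_eq_true_eq]
        grind
      have hsort : sortBy ⟨X :: l, hne, hd⟩ L = L.filter (fun R => R.support ⊆ X) ++
          sortBy ⟨l, fun Y hY => hne Y (List.mem_cons_of_mem _ hY), hd.of_cons⟩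
            (L.filter fun R => ¬ R.support ⊆ X) := by
        rw [sortBy, List.flatMap_cons]
        congr 1
        refine List.flatMap_congr fun Y hY => ?_
        rw [List.filter_filter]
        refine List.filter_congr fun R hR => ?_
        rw [eq_comm, ← Bool.decide_and, decide_eq_decide, and_iff_left_iff_imp]
        intro hRY hRX
        obtain ⟨a, ha⟩ := hL R hR
        exact Finset.disjoint_left.1 (hX Y hY) (hRX ha) (hRY ha)
      rw [hfit, hsort, TensorProduct.map_tmul, TensorProduct.lift.tmul, LinearMap.id_apply]
      exact ⟨fun h => by rw [ih.1 h, factProd_append], fun h => by rw [ih.2 h, map_zero]⟩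

section

variable {A : Finset ℕ+} {L : List SetComp}

theorem IsFact.support_nonempty (h : IsFact A L) : ∀ R ∈ L, R.support.Nonempty :=
  fun R hR => (h.dagger R hR).support_nonempty

theorem wedgeLeft_factProd (h : IsFact A L) {P : SetComp} (hP : P.support = A) (hfit : Fits P L) :
    wedgeLeft F P (factProd F L) = factProd F (sortBy P L) :=
  (wedgeLeft_factProd_aux P.parts P.nonempty P.disjoint L h.support_nonempty
    fun _ hR => (h.subset hR).trans hP.ge).1 hfit

theorem wedgeLeft_factProd_eq_zero (h : IsFact A L) {P : SetComp} (hP : P.support = A)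
    (hfit : ¬ Fits P L) : wedgeLeft F P (factProd F L) = 0 :=
  (wedgeLeft_factProd_aux P.parts P.nonempty P.disjoint L h.support_nonempty
    fun _ hR => (h.subset hR).trans hP.ge).2 hfit

theorem IsFact.nodup (h : IsFact A L) : L.Nodup := by
  refine List.Pairwise.imp_of_mem (fun {R R'} hR _ hd he => ?_) h.disjoint
  subst he
  exact (h.support_nonempty R hR).ne_empty (disjoint_self.1 hd)

theorem IsFact.sortBy_perm (h : IsFact A L) {P : SetComp} (hfit : Fits P L) :
    (sortBy P L).Perm L := by
  refine (List.perm_ext_iff_of_nodup ?_ h.nodup).2 fun R => ?_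
  · refine List.nodup_flatMap.2 ⟨fun X _ => h.nodup.filter _, P.disjoint.imp fun {X Y} hXY => ?_⟩
    intro R hR hR'
    simp only [List.mem_filter, decide_eq_true_eq] at hR hR'
    obtain ⟨a, ha⟩ := h.support_nonempty R hR.1
    exact Finset.disjoint_left.1 hXY (hR.2 ha) (hR'.2 ha)
  · simp only [sortBy, List.mem_flatMap, List.mem_filter, decide_eq_true_eq]
    exact ⟨fun ⟨_, _, h, _⟩ => h, fun hR => (hfit R hR).imp fun X hX => ⟨hX.1, hR, hX.2⟩⟩

/-- The set composition of the supports of the factors. -/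
def IsFact.suppComp (h : IsFact A L) : SetComp where
  parts := L.map SetComp.support
  nonempty X hX := by
    obtain ⟨R, hR, rfl⟩ := List.mem_map.1 hX
    exact h.support_nonempty R hR
  disjoint := List.pairwise_map.2 h.disjoint

theorem IsFact.support_suppComp (h : IsFact A L) : h.suppComp.support = A := by
  ext a
  rw [h.mem_iff, mem_support]
  simp [suppComp]

theorem IsFact.fits_suppComp {L' : List SetComp} (h : IsFact A L) (hL : L.Perm L') :
    Fits h.suppComp L' := fun R hR =>
  ⟨R.support, List.mem_map_of_mem (hL.mem_iff.2 hR), subset_rfl⟩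

theorem IsFact.eq_of_subset (h : IsFact A L) {R R' : SetComp} (hR : R ∈ L) (hR' : R' ∈ L)
    (hs : R.support ⊆ R'.support) : R = R' := by
  by_contra hne
  have : Std.Symm fun R R' : SetComp => Disjoint R.support R'.support := ⟨fun _ _ h => h.symm⟩
  have hd : Disjoint R.support R'.support := h.disjoint.forall hR hR' hne
  obtain ⟨a, ha⟩ := h.support_nonempty R hR
  exact Finset.disjoint_left.1 hd ha (hs ha)

theorem IsFact.sortBy_suppComp {L' : List SetComp} (h : IsFact A L) (hL : L.Perm L') :
    sortBy h.suppComp L' = L := by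
  classical
  have h' := h.perm hL
  have key : ∀ R ∈ L, (L'.filter fun Q => Q.support ⊆ R.support) = [R] := by
    intro R hR
    have h1 : (L'.filter fun Q => Q.support ⊆ R.support) = L'.filter fun Q => Q = R := by
      refine List.filter_congr fun Q hQ => ?_
      rw [decide_eq_decide]
      exact ⟨fun hs => h'.eq_of_subset hQ (hL.mem_iff.1 hR) hs, fun h => h ▸ subset_rfl⟩
    rw [h1]
    refine List.perm_singleton.1 ((List.perm_ext_iff_of_nodup (h'.nodup.filter _) (by simp)).2 ?_)
    intro Q
    simp only [List.mem_filter, decide_eq_true_eq, List.mem_singleton]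
    exact ⟨fun h => h.2, fun h => ⟨h ▸ hL.mem_iff.1 hR, h⟩⟩
  rw [sortBy, suppComp, List.flatMap_map, List.flatMap_congr key, List.flatMap_singleton']

/-- Each component of this composition is the support of exactly one factor, so multiplying by it
arranges the factors in any prescribed order. Differences of such operators produce commutators. -/
theorem IsFact.wedgeLeft_suppComp {L' : List SetComp} (h : IsFact A L) (hL : L.Perm L') :
    wedgeLeft F h.suppComp (factProd F L') = factProd F L := by
  rw [wedgeLeft_factProd (h.perm hL) h.support_suppComp (h.fits_suppComp hL), h.sortBy_suppComp hL]

end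

/-! ### Spanning -/

theorem vee_mem_filt {A B : Finset ℕ+} (hd : Disjoint A B) {f g : FPi F} (hf : f ∈ filt F A 0)
    (hg : g ∈ filt F B 0) : vee F f g ∈ filt F (A ∪ B) 0 := by
  induction hf using Submodule.span_induction with
  | mem f hf =>
    obtain ⟨L, hL, -, rfl⟩ := hf
    induction hg using Submodule.span_induction with
    | mem f hf =>
      obtain ⟨L', hL', -, rfl⟩ := hf
      rw [← factProd_append]
      refine factProd_mem_filt ⟨?_, ?_, ?_⟩ (Nat.zero_le _)
      · exact fun R hR => (List.mem_append.1 hR).elim (hL.dagger R) (hL'.dagger R)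
      · exact List.pairwise_append.2 ⟨hL.disjoint, hL'.disjoint, fun R hR R' hR' =>
          hd.mono (hL.subset hR) (hL'.subset hR')⟩
      · intro a
        simp only [Finset.mem_union, hL.mem_iff, hL'.mem_iff, List.mem_append, or_and_right,
          exists_or]
    | zero => simp
    | add x y _ _ hx hy => simpa using add_mem hx hy
    | smul a x _ hx => simpa using Submodule.smul_mem _ a hx
  | zero => simp
  | add x y _ _ hx hy => simpa using add_mem hx hy
  | smul a x _ hx => simpa using Submodule.smul_mem _ a hx

theorem eSet_mem_filt {B : Finset ℕ+} (hB : B.Nonempty) : eSet F B ∈ filt F B 0 := by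
  have h : IsFact B [SetComp.single B hB] := by
    refine ⟨?_, by simp, by simp⟩
    simp only [List.mem_singleton, forall_eq]
    exact ⟨B, rfl, B.min' hB, B.min'_mem hB, by simpa using B.isLeast_min' hB⟩
  have := factProd_mem_filt (F := F) h (Nat.zero_le _)
  rwa [factProd_cons, factProd_nil, vee_veeOne] at this

theorem single_mem_filt_of_parts : ∀ (l : List (Finset ℕ+)) (hne : ∀ X ∈ l, X.Nonempty)
    (hd : l.Pairwise Disjoint),
    (∀ X (hX : X ∈ l), Finsupp.single (SetComp.single X (hne X hX)) 1 ∈ filt F X 0) →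
    Finsupp.single (⟨l, hne, hd⟩ : SetComp) 1 ∈ filt F (l.foldr (· ∪ ·) ∅) 0
  | [], _, _, _ => factProd_mem_filt (L := []) ⟨by simp, by simp, by simp⟩ le_rfl
  | X :: l, hne, hd, h => by
    have ih := single_mem_filt_of_parts l (fun Y hY => hne Y (List.mem_cons_of_mem _ hY))
      hd.of_cons fun Y hY => h Y (List.mem_cons_of_mem _ hY)
    have hdisj : Disjoint X (l.foldr (· ∪ ·) ∅) := by
      refine Finset.disjoint_left.2 fun a ha ha' => ?_
      obtain ⟨Y, hY, haY⟩ := mem_foldr_union.1 ha'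
      exact Finset.disjoint_left.1 ((List.pairwise_cons.1 hd).1 Y hY) ha haY
    have h1 := vee_mem_filt hdisj (h X (by simp)) ih
    rw [vee_single, dif_pos (by rw [support_single]; exact hdisj), mul_one] at h1
    exact h1

/-- Triangularity: e_B is (B) plus signed compositions whose components are proper subsets of B, so
(B) is obtained by induction on B. -/
theorem single_single_mem_filt (B : Finset ℕ+) (hB : B.Nonempty) :
    Finsupp.single (SetComp.single B hB) 1 ∈ filt F B 0 := by
  classical
  induction B using Finset.strongInduction with
  | H B ih =>
    let P₀ : On B := ⟨SetComp.single B hB, support_single B hB⟩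
    have hP₀ : P₀ ∈ Finset.univ.filter fun P : On B => P.1.IsStar :=
      Finset.mem_filter.2 ⟨Finset.mem_univ _,
        B, rfl, B.min' hB, B.min'_mem hB, by rw [P₀.2]; exact B.isLeast_min' hB⟩
    have h1 : eSet F B = Finsupp.single P₀.1 1 +
        ∑ P ∈ (Finset.univ.filter fun P : On B => P.1.IsStar).erase P₀,
          Finsupp.single P.1 ((-1) ^ (P.1.length - 1)) := by
      rw [eSet, ← Finset.add_sum_erase _ _ hP₀]
      congr 1
      simp [P₀, SetComp.single, SetComp.length]
    have h2 : ∑ P ∈ (Finset.univ.filter fun P : On B => P.1.IsStar).erase P₀,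
        Finsupp.single P.1 ((-1 : F) ^ (P.1.length - 1)) ∈ filt F B 0 := by
      refine Submodule.sum_mem _ fun P hP => ?_
      have hne : P ≠ P₀ := (Finset.mem_erase.1 hP).1
      have h3 : ∀ X ∈ P.1.parts, X ⊂ B := by
        intro X hX
        have hsub : ∀ Y ∈ P.1.parts, Y ⊆ B := fun Y hY a ha => P.2 ▸ mem_support.2 ⟨Y, hY, ha⟩
        refine (hsub X hX).ssubset_of_ne fun hXB => hne (Subtype.ext (SetComp.ext ?_))
        change P.1.parts = [B]
        subst hXB
        refine List.perm_singleton.1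
          ((List.perm_ext_iff_of_nodup (nodup_parts P.1) (by simp)).2 fun Y => ?_)
        rw [List.mem_singleton]
        refine ⟨fun hY => ?_, fun h => h ▸ hX⟩
        by_contra hYX
        have hd : Disjoint Y X := P.1.disjoint.forall hY hX hYX
        obtain ⟨a, ha⟩ := P.1.nonempty Y hY
        exact Finset.disjoint_left.1 hd ha (hsub Y hY ha)
      have h4 := single_mem_filt_of_parts (F := F) P.1.parts P.1.nonempty P.1.disjoint
        fun X hX => ih X (h3 X hX) (P.1.nonempty X hX)
      have h5 : P.1.parts.foldr (· ∪ ·) ∅ = B := P.2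
      rw [h5] at h4
      have := Submodule.smul_mem _ ((-1 : F) ^ (P.1.length - 1)) h4
      rwa [Finsupp.smul_single, smul_eq_mul, mul_one] at this
    have h3 := sub_mem (eSet_mem_filt (F := F) hB) h2
    rwa [h1, add_sub_cancel_right] at h3

theorem graded_le_filt (A : Finset ℕ+) : graded F A ≤ filt F A 0 := by
  rw [graded_eq_span, Submodule.span_le]
  rintro _ ⟨R, rfl, rfl⟩
  exact single_mem_filt_of_parts R.parts R.nonempty R.disjoint
    fun X hX => single_single_mem_filt X (R.nonempty X hX)

/-! ### The basis of FΠ_A -/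

variable {A : Finset ℕ+}

theorem incl_single (P : On A) (a : F) :
    incl F A (MonoidAlgebra.single P a) = Finsupp.single P.1 a := by
  change Finsupp.mapDomain Subtype.val (MonoidAlgebra.single P a).coeff = _
  rw [MonoidAlgebra.coeff_single]
  exact Finsupp.mapDomain_single

theorem incl_injective : Function.Injective (incl F A) := fun _ _ h =>
  MonoidAlgebra.coeff_injective (Finsupp.mapDomain_injective Subtype.val_injective h)

theorem incl_mem_graded (x : FPiOn F A) : incl F A x ∈ graded F A := by
  induction x using MonoidAlgebra.induction_linear with
  | zero => simp
  | add x y hx hy => simpa using add_mem hx hy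
  | single P a => simpa only [incl_single] using single_mem_graded P.2 a

theorem exists_incl_eq {f : FPi F} (hf : f ∈ graded F A) : ∃ x, incl F A x = f := by
  suffices h : graded F A ≤ LinearMap.range (incl F A) from h hf
  rw [graded_eq_span, Submodule.span_le]
  rintro _ ⟨R, hR, rfl⟩
  exact ⟨MonoidAlgebra.single ⟨R, hR⟩ 1, incl_single _ _⟩

theorem incl_single_mul (P : On A) (x : FPiOn F A) :
    incl F A (MonoidAlgebra.single P 1 * x) = wedgeLeft F P.1 (incl F A x) := by
  induction x using MonoidAlgebra.induction_linear with
  | zero => simp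
  | add x y hx hy => rw [mul_add, map_add, hx, hy, map_add, map_add]
  | single Q a =>
    rw [MonoidAlgebra.single_mul_single, incl_single, incl_single, wedgeLeft_single, one_mul]
    rfl

theorem factProd_mem_graded {L : List SetComp} (h : IsFact A L) : factProd F L ∈ graded F A := by
  have key : ∀ L : List SetComp,
      factProd F L ∈ graded F ((L.map SetComp.support).foldr (· ∪ ·) ∅) := by
    intro L
    induction L with
    | nil => exact veeOne_mem_graded
    | cons R L ih => exact vee_mem_graded (isPrim_brk R.parts).1 ih
  have h1 : (L.map SetComp.support).foldr (· ∪ ·) ∅ = A := by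
    ext a
    rw [mem_foldr_union, h.mem_iff]
    simp
  exact h1 ▸ key L

namespace PBWIndex

theorem isFact (i : PBWIndex A) : IsFact A i.factors := by
  obtain ⟨P, hP, hA, -⟩ := i.increasing
  refine ⟨i.dagger, ?_, fun a => ?_⟩
  · have := P.disjoint
    rwa [hP, List.pairwise_map] at this
  · have h := mem_support (Q := P) (a := a)
    rw [hP, hA] at h
    simpa using h

theorem isSortedFact (i : PBWIndex A) : IsSortedFact i.factors := by
  obtain ⟨P, hP, -, h⟩ := i.increasing
  rwa [SetComp.IsIncreasing, hP, List.pairwise_map] at h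

theorem length_total (i : PBWIndex A) :
    i.total.length = i.factors.length + factDeg i.factors := by
  rw [SetComp.length, i.total_parts, IsFact.length_flatten i.dagger]

end PBWIndex

theorem pbwElement_eq (i : PBWIndex A) : pbwElement F i = factProd F i.factors := by
  simp only [pbwElement, factProd, eLin_circ]

theorem IsFact.exists_index {L : List SetComp} (h : IsFact A L) (hL : IsSortedFact L) :
    ∃ i : PBWIndex A, i.factors = L :=
  ⟨⟨L, h.total, h.dagger, rfl, h.support_total, h.suppComp, rfl, h.support_suppComp,
    List.pairwise_map.2 hL⟩, rfl⟩

theorem SetComp.IsDagger.exists_last {R : SetComp} (h : R.IsDagger) :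
    ∃ u X a, R.parts = u ++ [X] ∧ a ∈ X ∧ IsLeast (R.support : Set ℕ+) a := by
  obtain ⟨X, hX, a, haX, ha⟩ := h
  obtain ⟨u, hu⟩ := List.getLast?_eq_some_iff.1 hX
  exact ⟨u, X, a, hu, haX, ha⟩

theorem IsSortedFact.le_of_mem {R : SetComp} {L : List SetComp} {a : ℕ+}
    (hs : IsSortedFact (R :: L)) (ha : IsLeast (R.support : Set ℕ+) a) :
    ∀ Y ∈ ((R :: L).map SetComp.parts).flatten, ∀ y ∈ Y, a ≤ y := by
  intro Y hY y hy
  obtain ⟨Q, hQ, hYQ⟩ : ∃ Q ∈ R :: L, Y ∈ Q.parts := by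
    simpa only [List.mem_flatten, List.mem_map, exists_exists_and_eq_and] using hY
  have hyQ : y ∈ Q.support := mem_support.2 ⟨Y, hYQ, hy⟩
  rcases List.mem_cons.1 hQ with rfl | hQ
  · exact ha.2 hyQ
  · have h1 := (List.pairwise_cons.1 hs).1 Q hQ
    have h2 : R.support.min = a :=
      le_antisymm (Finset.min_le ha.1) (Finset.le_min fun b hb => WithTop.coe_le_coe.2 (ha.2 hb))
    rw [h2] at h1
    exact WithTop.coe_le_coe.1 (h1.le.trans (Finset.min_le hyQ))

/-- The first factor of a sorted list contains the overall minimum, and has it in its last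
component. The flattened list therefore shows where the first factor ends, and the argument repeats
on the rest. -/
theorem eq_of_flatten_eq : ∀ {L L' : List SetComp}, (∀ R ∈ L, R.IsDagger) →
    (∀ R ∈ L', R.IsDagger) → IsSortedFact L → IsSortedFact L' →
    (L.map SetComp.parts).flatten.Pairwise Disjoint →
    (L.map SetComp.parts).flatten.Nodup →
    (L.map SetComp.parts).flatten = (L'.map SetComp.parts).flatten → L = L'
  | [], [], _, _, _, _, _, _, _ => rfl
  | [], R :: L', _, h', _, _, _, _, h => by
    have := (h' R (by simp)).parts_ne_nil
    simp_all
  | R :: L, [], h', _, _, _, _, _, h => by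
    have := (h' R (by simp)).parts_ne_nil
    simp_all
  | R :: L, R' :: L', hd, hd', hs, hs', hdisj, hnd, h => by
    obtain ⟨u, X, a, hu, haX, ha⟩ := (hd R (by simp)).exists_last
    obtain ⟨u', X', a', hu', haX', ha'⟩ := (hd' R' (by simp)).exists_last
    have hX : X ∈ ((R :: L).map SetComp.parts).flatten := by simp [hu]
    have hX' : X' ∈ ((R' :: L').map SetComp.parts).flatten := by simp [hu']
    have haa : a = a' := le_antisymm (hs.le_of_mem ha X' (h ▸ hX') a' haX')
      (hs'.le_of_mem ha' X (h ▸ hX) a haX)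
    subst haa
    have hXX : X = X' := by
      by_contra hne
      exact Finset.disjoint_left.1 (hdisj.forall hX (h ▸ hX') hne) haX haX'
    subst hXX
    simp only [List.map_cons, List.flatten_cons, hu, hu', List.append_assoc, List.singleton_append]
      at h hnd hdisj
    have h1 := List.nodup_middle.1 hnd
    rw [List.nodup_cons, List.mem_append, not_or] at h1
    obtain ⟨h2, -, h3⟩ := (List.append_cons_inj_of_notMem h1.1.1 h1.1.2).1 h
    have hR : R = R' := SetComp.ext (by rw [hu, hu', h2])
    rw [hR, eq_of_flatten_eq (fun Q hQ => hd Q (by simp [hQ])) (fun Q hQ => hd' Q (by simp [hQ]))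
      hs.of_cons hs'.of_cons (List.pairwise_append.1 hdisj).2.1.of_cons
      (List.nodup_append.1 hnd).2.1.of_cons h3]

theorem PBWIndex.total_injective :
    Function.Injective fun i : PBWIndex A => (⟨i.total, i.total_support⟩ : On A) := by
  intro i j h
  have ht : i.total = j.total := congrArg Subtype.val h
  refine PBWIndex.ext (eq_of_flatten_eq i.dagger j.dagger i.isSortedFact j.isSortedFact ?_ ?_ ?_) ht
  · exact i.total_parts ▸ i.total.disjoint
  · exact i.total_parts ▸ nodup_parts i.total
  · rw [← i.total_parts, ← j.total_parts, ht]

theorem sortedFilt_eq_span (k : ℕ) :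
    sortedFilt F A k =
      Submodule.span F (pbwElement F '' {i : PBWIndex A | k ≤ factDeg i.factors}) := by
  rw [sortedFilt]
  congr 1
  ext f
  constructor
  · rintro ⟨L, h, hs, hk, rfl⟩
    obtain ⟨i, rfl⟩ := h.exists_index hs
    exact ⟨i, hk, pbwElement_eq i⟩
  · rintro ⟨i, hk, rfl⟩
    exact ⟨i.factors, i.isFact, i.isSortedFact, hk, (pbwElement_eq i).symm⟩

theorem exists_basis_pbwElement (F : Type*) [Field F] (A : Finset ℕ+) :
    ∃ b : Module.Basis (PBWIndex A) F (FPiOn F A), ∀ i, incl F A (b i) = pbwElement F i := by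
  classical
  have hv : ∀ i : PBWIndex A, ∃ x, incl F A x = pbwElement F i := fun i =>
    exists_incl_eq (by rw [pbwElement_eq]; exact factProd_mem_graded i.isFact)
  choose v hv using hv
  have hspan : ⊤ ≤ Submodule.span F (Set.range v) := by
    intro x _
    have h1 : incl F A x ∈ sortedFilt F A 0 :=
      filt_le_sortedFilt A 0 (graded_le_filt A (incl_mem_graded x))
    have h2 : pbwElement F '' {i : PBWIndex A | 0 ≤ factDeg i.factors} =
        incl F A '' Set.range v := by
      rw [← Set.range_comp, show (incl F A ∘ v) = pbwElement F from funext hv]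
      simp
    rw [sortedFilt_eq_span, h2, ← Submodule.map_span] at h1
    obtain ⟨y, hy, hyx⟩ := h1
    exact incl_injective hyx ▸ hy
  have : Finite (PBWIndex A) := Finite.of_injective (β := On A) _ PBWIndex.total_injective
  have : Fintype (PBWIndex A) := Fintype.ofFinite _
  -- A spanning family with at most |Π_A| = dim FΠ_A members is independent; concatenating the
  -- factors embeds the index set in Π_A.
  have hli : LinearIndependent F v := by
    rw [linearIndependent_iff_card_le_finrank_span, Set.finrank, top_le_iff.1 hspan, finrank_top,
      (MonoidAlgebra.coeffLinearEquiv F).finrank_eq, Module.finrank_finsupp_self]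
    exact Fintype.card_le_of_injective _ PBWIndex.total_injective
  exact ⟨.mk hli hspan, fun i => by rw [Module.Basis.mk_apply, hv]⟩

/-! ### The filtration by left ideals and the Jacobson radical -/

theorem wedgeLeft_mem_sortedFilt {P : SetComp} (hP : P.support = A) {k : ℕ} {f : FPi F}
    (hf : f ∈ sortedFilt F A k) : wedgeLeft F P f ∈ sortedFilt F A k := by
  induction hf using Submodule.span_induction with
  | mem f hf =>
    obtain ⟨L, h, -, hk, rfl⟩ := hf
    by_cases hfit : Fits P L
    · rw [wedgeLeft_factProd h hP hfit]
      have hp := (h.sortBy_perm hfit).symm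
      exact filt_le_sortedFilt A k (factProd_mem_filt (h.perm hp) (hk.trans (factDeg_perm hp).le))
    · rw [wedgeLeft_factProd_eq_zero h hP hfit]
      exact zero_mem _
  | zero => simp
  | add x y _ _ hx hy => simpa using add_mem hx hy
  | smul a x _ hx => simpa using Submodule.smul_mem _ a hx

theorem wedgeLeft_factProd_sub_mem {L : List SetComp} (h : IsFact A L) {P : SetComp}
    (hP : P.support = A) (hfit : Fits P L) :
    wedgeLeft F P (factProd F L) - factProd F L ∈ sortedFilt F A (factDeg L + 1) := by
  rw [wedgeLeft_factProd h hP hfit, ← neg_sub]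
  exact neg_mem (filt_le_sortedFilt A _ (factProd_perm h (h.sortBy_perm hfit).symm))

/-- Modulo the next step, P fixes the products that fit it and kills the others. Its action there
depends only on which lists fit. -/
theorem wedgeLeft_sub_wedgeLeft_mem {P P' : SetComp} (hP : P.support = A) (hP' : P'.support = A)
    (hfit : ∀ L, Fits P L ↔ Fits P' L) {k : ℕ} {f : FPi F} (hf : f ∈ sortedFilt F A k) :
    wedgeLeft F P f - wedgeLeft F P' f ∈ sortedFilt F A (k + 1) := by
  induction hf using Submodule.span_induction with
  | mem f hf =>
    obtain ⟨L, h, -, hk, rfl⟩ := hf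
    by_cases hL : Fits P L
    · have h1 := sub_mem (wedgeLeft_factProd_sub_mem (F := F) h hP hL)
        (wedgeLeft_factProd_sub_mem (F := F) h hP' ((hfit L).1 hL))
      rw [sub_sub_sub_cancel_right] at h1
      exact sortedFilt_anti A (by omega) h1
    · rw [wedgeLeft_factProd_eq_zero h hP hL,
        wedgeLeft_factProd_eq_zero h hP' (mt (hfit L).2 hL), sub_zero]
      exact zero_mem _
  | zero => simp
  | add x y _ _ hx hy =>
    rw [map_add, map_add, add_sub_add_comm]
    exact add_mem hx hy
  | smul a x _ hx =>
    rw [map_smul, map_smul, ← smul_sub]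
    exact Submodule.smul_mem _ a hx

theorem mul_mem_of_single_mul_mem {N N' : Submodule F (FPiOn F A)}
    (h : ∀ P : On A, ∀ x ∈ N, MonoidAlgebra.single P 1 * x ∈ N') (a : FPiOn F A)
    {x : FPiOn F A} (hx : x ∈ N) : a * x ∈ N' := by
  induction a using MonoidAlgebra.induction_on with
  | of P => exact h P x hx
  | add a b ha hb => rw [add_mul]; exact add_mem ha hb
  | smul r a ha => rw [smul_mul_assoc]; exact Submodule.smul_mem _ r ha

/-- The filtration of `FΠ_A` by the products of Lie monomials of degree at least `k`, as a
sequence of left ideals. -/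
noncomputable def idealFilt (F : Type*) [Field F] (A : Finset ℕ+) (k : ℕ) :
    Submodule (FPiOn F A) (FPiOn F A) where
  toAddSubmonoid := ((sortedFilt F A k).comap (incl F A)).toAddSubmonoid
  smul_mem' a x hx := by
    refine mul_mem_of_single_mul_mem (N := (sortedFilt F A k).comap (incl F A))
      (N' := (sortedFilt F A k).comap (incl F A)) (fun P x hx => ?_) a hx
    rw [Submodule.mem_comap, incl_single_mul]
    exact wedgeLeft_mem_sortedFilt P.2 hx

theorem mem_idealFilt {k : ℕ} {x : FPiOn F A} :
    x ∈ idealFilt F A k ↔ incl F A x ∈ sortedFilt F A k := Iff.rfl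

theorem idealFilt_zero : idealFilt F A 0 = ⊤ :=
  top_le_iff.1 fun x _ => filt_le_sortedFilt A 0 (graded_le_filt A (incl_mem_graded x))

theorem idealFilt_eq_bot : idealFilt F A (A.card + 1) = ⊥ := by
  refine le_bot_iff.1 fun x hx => ?_
  have h1 : sortedFilt F A (A.card + 1) = ⊥ := by
    refine Submodule.span_eq_bot.2 ?_
    rintro _ ⟨L, h, -, hk, -⟩
    have := h.factDeg_le
    omega
  rw [mem_idealFilt, h1, Submodule.mem_bot] at hx
  exact incl_injective (by rw [hx, map_zero])

theorem idealFilt_restrictScalars_eq_span {b : Module.Basis (PBWIndex A) F (FPiOn F A)}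
    (hb : ∀ i, incl F A (b i) = pbwElement F i) (k : ℕ) :
    (idealFilt F A k).restrictScalars F =
      Submodule.span F (b '' {i | k ≤ factDeg i.factors}) := by
  have h1 : pbwElement F '' {i : PBWIndex A | k ≤ factDeg i.factors} =
      incl F A '' (b '' {i | k ≤ factDeg i.factors}) := by
    rw [← Set.image_comp]
    exact Set.image_congr fun i _ => (hb i).symm
  have h2 : (idealFilt F A k).restrictScalars F = (sortedFilt F A k).comap (incl F A) := rfl
  rw [h2, sortedFilt_eq_span, h1, ← Submodule.map_span,
    Submodule.comap_map_eq_of_injective incl_injective]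

/-- For every y, the element yx also raises the filtration, as its terms are left ideals. The
filtration reaches 0, so yx is nilpotent and 1 + yx is invertible. -/
theorem mem_ringJacobson {x : FPiOn F A}
    (hx : ∀ k, ∀ z ∈ idealFilt F A k, x * z ∈ idealFilt F A (k + 1)) :
    x ∈ Ring.jacobson (FPiOn F A) := by
  rw [← Ideal.jacobson_bot, Ideal.mem_jacobson_iff]
  intro y
  have h1 : ∀ n, (y * x) ^ n ∈ idealFilt F A n := by
    intro n
    induction n with
    | zero => rw [idealFilt_zero]; trivial
    | succ n ih =>
      rw [pow_succ', mul_assoc]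
      exact Submodule.smul_mem _ y (hx n _ ih)
  have h2 : IsNilpotent (y * x) := ⟨A.card + 1, by simpa [idealFilt_eq_bot] using h1 (A.card + 1)⟩
  obtain ⟨z, hz⟩ := h2.isUnit_one_add.exists_left_inv
  refine ⟨z, ?_⟩
  rw [mul_add, mul_one] at hz
  rw [Ideal.mem_bot, ← hz, mul_assoc]
  abel

/-- Positive degree forces a factor e_X ∘ g of length at least 2. Splitting it into the two factors
e_X and g lowers the degree by one and gives w; the two orders of these factors are produced by P
and P', so P - P' restores the bracket. -/
theorem exists_jacobson_mul_eq {L : List SetComp} (h : IsFact A L)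
    {k : ℕ} (hk : k + 1 ≤ factDeg L) {y : FPiOn F A} (hy : incl F A y = factProd F L) :
    ∃ x ∈ Ring.jacobson (FPiOn F A), ∃ w ∈ idealFilt F A k, y = x * w := by
  obtain ⟨R, hR, hlen⟩ : ∃ R ∈ L, 2 ≤ R.length := by
    by_contra! hc
    have : factDeg L = 0 := by
      refine List.sum_eq_zero fun n hn => ?_
      obtain ⟨R, hR, rfl⟩ := List.mem_map.1 hn
      have := hc R hR
      omega
    omega
  obtain ⟨K, K', rfl⟩ := List.append_of_mem hR
  obtain ⟨l, hne, hd⟩ := R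
  match l, hne, hd, hlen with
  | X :: Y :: l, hne, hd, hlen =>
  have hRd := h.dagger _ hR
  have hX := hne X (by simp)
  let R₁ : SetComp := SetComp.single X hX
  let R₂ : SetComp := ⟨Y :: l, fun Z hZ => hne Z (List.mem_cons_of_mem _ hZ), hd.of_cons⟩
  have hdisj : Disjoint X R₂.support := by
    refine Finset.disjoint_left.2 fun a ha ha' => ?_
    obtain ⟨Z, hZ, haZ⟩ := mem_support.1 ha'
    exact Finset.disjoint_left.1 ((List.pairwise_cons.1 hd).1 Z hZ) ha haZ
  have hsupp : (⟨X :: Y :: l, hne, hd⟩ : SetComp).support = X ∪ R₂.support := rfl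
  have hR₁ : R₁.IsDagger :=
    ⟨X, rfl, X.min' hX, X.min'_mem hX, by rw [SetComp.support_single]; exact X.isLeast_min' hX⟩
  -- Only the first component is removed from a list of at least two, so the last one, with the
  -- minimum, remains.
  have hR₂ : R₂.IsDagger := by
    obtain ⟨Z, hZ, a, haZ, ha⟩ := hRd
    have hZ' : Z ∈ R₂.parts.getLast? := by simpa [R₂] using hZ
    have haR : a ∈ R₂.support := mem_support.2 ⟨Z, List.mem_of_getLast? hZ', haZ⟩
    refine ⟨Z, hZ', a, haZ, haR, fun c hc => ha.2 ?_⟩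
    rw [hsupp]
    exact Finset.mem_union_right _ hc
  have hdL := h.disjoint
  simp only [List.pairwise_append, List.pairwise_cons, List.mem_cons, forall_eq_or_imp, hsupp,
    Finset.disjoint_union_left, Finset.disjoint_union_right] at hdL
  obtain ⟨hd1, ⟨hd2, hd3⟩, hd4⟩ := hdL
  have hfact : IsFact A (K ++ R₁ :: R₂ :: K') := by
    refine ⟨?_, ?_, fun a => ?_⟩
    · have := h.dagger
      simp only [List.mem_append, List.mem_cons] at this ⊢
      grind
    · simp only [List.pairwise_append, List.pairwise_cons, List.mem_cons, forall_eq_or_imp, R₁,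
        SetComp.support_single]
      exact ⟨hd1, ⟨⟨hdisj, fun Q hQ => (hd2 Q hQ).1⟩, fun Q hQ => (hd2 Q hQ).2, hd3⟩,
        fun Q hQ => ⟨(hd4 Q hQ).1.1, (hd4 Q hQ).1.2, (hd4 Q hQ).2⟩⟩
    · rw [h.mem_iff]
      simp only [List.mem_append, List.mem_cons, or_and_right, exists_or, exists_eq_left, hsupp,
        Finset.mem_union, or_assoc, R₁, SetComp.support_single]
  have hperm : (K ++ R₂ :: R₁ :: K').Perm (K ++ R₁ :: R₂ :: K') :=
    (List.Perm.swap R₁ R₂ K').append_left K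
  have hfact' : IsFact A (K ++ R₂ :: R₁ :: K') := hfact.perm hperm.symm
  obtain ⟨w, hw⟩ := exists_incl_eq (F := F) (factProd_mem_graded hfact)
  let P : On A := ⟨hfact.suppComp, hfact.support_suppComp⟩
  let P' : On A := ⟨hfact'.suppComp, hfact'.support_suppComp⟩
  refine ⟨MonoidAlgebra.single P 1 - MonoidAlgebra.single P' 1, ?_, w, ?_, ?_⟩
  · refine mem_ringJacobson fun k z hz => ?_
    rw [mem_idealFilt, sub_mul, map_sub, incl_single_mul, incl_single_mul]
    -- P and P' have the same components in different orders, so the same lists fit both.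
    refine wedgeLeft_sub_wedgeLeft_mem P.2 P'.2 (fun M => ?_) hz
    simp only [Fits, P, P', IsFact.suppComp, (hperm.map SetComp.support).mem_iff]
  · rw [mem_idealFilt, hw]
    refine filt_le_sortedFilt A k (factProd_mem_filt hfact ?_)
    simp only [factDeg, List.map_append, List.map_cons, List.sum_append, List.sum_cons,
      SetComp.length, R₁, R₂, SetComp.single, List.length_cons, List.length_nil] at hk ⊢
    omega
  · refine incl_injective ?_
    rw [hy, sub_mul, map_sub, incl_single_mul, incl_single_mul, hw,
      hfact.wedgeLeft_suppComp (.refl _), hfact'.wedgeLeft_suppComp hperm]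
    simp only [factProd_append, factProd_cons, map_sub, R₁, R₂, SetComp.single, brk, lie,
      LinearMap.sub_apply, vee_assoc]

/-! ### The Loewy series -/

/-- The radical of a submodule. -/
def radSub {R M : Type*} [Ring R] [AddCommGroup M] [Module R M] (N : Submodule R M) :
    Submodule R M :=
  (Module.jacobson R N).map N.subtype

theorem smul_mem_radSub {R M : Type*} [Ring R] [AddCommGroup M] [Module R M] {N : Submodule R M}
    {x : R} (hx : x ∈ Ring.jacobson R) {w : M} (hw : w ∈ N) : x • w ∈ radSub N :=
  ⟨x • ⟨w, hw⟩, Ring.jacobson_smul_top_le R N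
    (Submodule.smul_mem_smul hx Submodule.mem_top), rfl⟩

theorem idealFilt_succ_le_radSub (k : ℕ) : idealFilt F A (k + 1) ≤ radSub (idealFilt F A k) := by
  intro y hy
  have h : sortedFilt F A (k + 1) ≤
      ((radSub (idealFilt F A k)).restrictScalars F).map (incl F A) := by
    refine Submodule.span_le.2 ?_
    rintro _ ⟨L, h, -, hk, rfl⟩
    obtain ⟨y, hy⟩ := exists_incl_eq (F := F) (factProd_mem_graded h)
    obtain ⟨x, hx, w, hw, rfl⟩ := exists_jacobson_mul_eq h hk hy
    exact Submodule.mem_map.2 ⟨x * w, smul_mem_radSub hx hw, hy⟩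
  obtain ⟨z, hz, hzy⟩ := Submodule.mem_map.1 (h (mem_idealFilt.1 hy))
  exact incl_injective hzy ▸ hz

section Basis

variable {b : Module.Basis (PBWIndex A) F (FPiOn F A)}

theorem mem_idealFilt_iff_repr (hb : ∀ i, incl F A (b i) = pbwElement F i) {k : ℕ}
    {x : FPiOn F A} :
    x ∈ idealFilt F A k ↔ ∀ i, b.repr x i ≠ 0 → k ≤ factDeg i.factors := by
  rw [← Submodule.restrictScalars_mem F, idealFilt_restrictScalars_eq_span hb,
    Module.Basis.mem_span_image]
  simp [Set.subset_def]

/-- On the kth step, P multiplies the ith coordinate by 1 or 0, according to whether the factors of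
i fit P: the error terms have degree above k and do not involve b i. -/
theorem repr_mul_eq_zero (hb : ∀ i, incl F A (b i) = pbwElement F i) {k : ℕ} {i : PBWIndex A}
    (hi : factDeg i.factors = k) (a : FPiOn F A) {x : FPiOn F A} (hx : x ∈ idealFilt F A k)
    (hxi : b.repr x i = 0) : b.repr (a * x) i = 0 := by
  have key : ∀ P : On A, ∃ c : F, ∀ x ∈ idealFilt F A k,
      b.repr (MonoidAlgebra.single P 1 * x) i = c * b.repr x i := by
    classical
    intro P
    refine ⟨if Fits P.1 i.factors then 1 else 0, fun x hx => ?_⟩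
    rw [← Submodule.restrictScalars_mem F, idealFilt_restrictScalars_eq_span hb] at hx
    induction hx using Submodule.span_induction with
    | mem x hx =>
      obtain ⟨j, hj, rfl⟩ := hx
      have h0 : ∀ y ∈ idealFilt F A (k + 1), b.repr y i = 0 := by
        intro y hy
        by_contra hne
        have := (mem_idealFilt_iff_repr hb).1 hy i hne
        omega
      by_cases hfit : Fits P.1 j.factors
      · have h1 : MonoidAlgebra.single P 1 * b j - b j ∈ idealFilt F A (k + 1) := by
          rw [mem_idealFilt, map_sub, incl_single_mul, hb, pbwElement_eq]
          have hj' : k ≤ factDeg j.factors := hj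
          exact sortedFilt_anti A (by omega) (wedgeLeft_factProd_sub_mem j.isFact P.2 hfit)
        have h2 := h0 _ h1
        rw [map_sub, Finsupp.sub_apply, sub_eq_zero] at h2
        rw [h2]
        rcases eq_or_ne j i with rfl | hji
        · rw [if_pos hfit, one_mul]
        · rw [b.repr_self, Finsupp.single_eq_of_ne hji.symm, mul_zero]
      · have h1 : MonoidAlgebra.single P 1 * b j = 0 := by
          refine incl_injective ?_
          rw [incl_single_mul, hb, pbwElement_eq, wedgeLeft_factProd_eq_zero j.isFact P.2 hfit,
            map_zero]
        rw [h1, map_zero, Finsupp.zero_apply]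
        rcases eq_or_ne j i with rfl | hji
        · rw [if_neg hfit, zero_mul]
        · rw [b.repr_self, Finsupp.single_eq_of_ne hji.symm, mul_zero]
    | zero => simp
    | add x y _ _ hx hy => rw [mul_add, map_add, map_add, Finsupp.add_apply, Finsupp.add_apply,
        hx, hy, mul_add]
    | smul r x _ hx => rw [mul_smul_comm, map_smul, map_smul, Finsupp.smul_apply,
        Finsupp.smul_apply, hx, smul_eq_mul, smul_eq_mul, mul_left_comm]
  have := mul_mem_of_single_mul_mem
    (N := (idealFilt F A k).restrictScalars F ⊓ LinearMap.ker (b.coord i))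
    (N' := LinearMap.ker (b.coord i)) (fun P x hx => ?_) a (x := x) ⟨hx, by simpa using hxi⟩
  · simpa using this
  · obtain ⟨c, hc⟩ := key P
    have h2 : b.repr x i = 0 := by simpa using hx.2
    rw [LinearMap.mem_ker, Module.Basis.coord_apply, hc x hx.1, h2, mul_zero]

/-- The elements of the `k`th filtration submodule with vanishing coefficient at `b i`. -/
def coordKer (hb : ∀ i, incl F A (b i) = pbwElement F i) {k : ℕ} {i : PBWIndex A}
    (hi : factDeg i.factors = k) : Submodule (FPiOn F A) (idealFilt F A k) where
  carrier := {x | b.repr x.1 i = 0}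
  add_mem' {x y} hx hy := by
    have hx' : b.repr x.1 i = 0 := hx
    have hy' : b.repr y.1 i = 0 := hy
    simp [hx', hy']
  zero_mem' := by simp
  smul_mem' a x hx := repr_mul_eq_zero hb hi a x.2 hx

theorem mem_coordKer (hb : ∀ i, incl F A (b i) = pbwElement F i) {k : ℕ} {i : PBWIndex A}
    (hi : factDeg i.factors = k) {x : idealFilt F A k} :
    x ∈ coordKer hb hi ↔ b.repr x.1 i = 0 := Iff.rfl

/-- The submodule is proper because it misses b i, and maximal because it already has codimension
one over F. -/
theorem isCoatom_coordKer (hb : ∀ i, incl F A (b i) = pbwElement F i) {k : ℕ} {i : PBWIndex A}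
    (hi : factDeg i.factors = k) : IsCoatom (coordKer hb hi) := by
  classical
  refine ⟨fun h => ?_, fun N hN => ?_⟩
  · have hbi : b i ∈ idealFilt F A k := by
      rw [mem_idealFilt, hb, pbwElement_eq]
      exact factProd_mem_sortedFilt i.isFact i.isSortedFact hi.ge
    have h1 : (⟨b i, hbi⟩ : idealFilt F A k) ∈ coordKer hb hi := h ▸ trivial
    rw [mem_coordKer] at h1
    simp at h1
  · obtain ⟨hle, y, hyN, hy⟩ := SetLike.lt_iff_le_and_exists.1 hN
    rw [mem_coordKer] at hy
    refine top_le_iff.1 fun z _ => ?_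
    let c : FPiOn F A := algebraMap F _ (b.repr z.1 i / b.repr y.1 i)
    have h1 : z - c • y ∈ coordKer hb hi := by
      rw [mem_coordKer]
      change b.repr (z.1 - c * y.1) i = 0
      rw [← Algebra.smul_def, map_sub, map_smul, Finsupp.sub_apply, Finsupp.smul_apply,
        smul_eq_mul, div_mul_cancel₀ _ hy, sub_self]
    simpa using add_mem (hle h1) (N.smul_mem c hyN)

/-- A radical element lies in every coordinate kernel of degree k, so only basis elements of larger
degree occur in it. -/
theorem radSub_le_idealFilt_succ (hb : ∀ i, incl F A (b i) = pbwElement F i) (k : ℕ) :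
    radSub (idealFilt F A k) ≤ idealFilt F A (k + 1) := by
  rintro _ ⟨x, hx, rfl⟩
  rw [mem_idealFilt_iff_repr hb]
  intro i hi
  have h1 := (mem_idealFilt_iff_repr hb).1 x.2 i hi
  refine lt_of_le_of_ne h1 fun h => hi ?_
  exact (Submodule.mem_sInf.1 hx) (coordKer hb h.symm) (isCoatom_coordKer hb h.symm)

theorem loewy_eq_idealFilt (hb : ∀ i, incl F A (b i) = pbwElement F i) (k : ℕ) :
    loewy (FPiOn F A) (FPiOn F A) k = idealFilt F A k := by
  induction k with
  | zero => exact idealFilt_zero.symm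
  | succ k ih =>
    change radSub (loewy (FPiOn F A) (FPiOn F A) k) = _
    rw [ih]
    exact le_antisymm (radSub_le_idealFilt_succ hb k) (idealFilt_succ_le_radSub k)

end Basis

end SolomonTits

theorem corollary7p5 (F : Type*) [Field F] (A : Finset ℕ+) :
    ∃ b : Module.Basis (SolomonTits.PBWIndex A) F (SolomonTits.FPiOn F A),
      (∀ i, SolomonTits.incl F A (b i) = SolomonTits.pbwElement F i) ∧
      ∀ k : ℕ,
        SolomonTits.IsComplementIn
          (Submodule.span F (b '' {i | i.total.length = i.factors.length + k}))
          (SolomonTits.radPow F A (k + 1)) (SolomonTits.radPow F A k) := by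
  obtain ⟨b, hb⟩ := SolomonTits.exists_basis_pbwElement F A
  refine ⟨b, hb, fun k => ?_⟩
  have hk : ∀ k, SolomonTits.radPow F A k =
      Submodule.span F (b '' {i | k ≤ SolomonTits.factDeg i.factors}) := fun k => by
    rw [SolomonTits.radPow, SolomonTits.loewy_eq_idealFilt hb,
      SolomonTits.idealFilt_restrictScalars_eq_span hb]
  -- The degree is ℓ(Q) - m, so condition (e) selects the basis elements of degree exactly k.
  have hset : {i : SolomonTits.PBWIndex A | i.total.length = i.factors.length + k} =
      {i | SolomonTits.factDeg i.factors = k} := by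
    ext i
    simp only [Set.mem_ofPred_eq, i.length_total]
    omega
  rw [hk, hk, hset]
  constructor
  · refine b.linearIndependent.disjoint_span_image (Set.disjoint_left.2 fun i hi hi' => ?_)
    simp only [Set.mem_ofPred_eq] at hi hi'
    omega
  · rw [← Submodule.span_union, ← Set.image_union]
    congr 2
    ext i
    simp only [Set.mem_union, Set.mem_ofPred_eq]
    omega
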